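/- Let $d\ge 1$, $k\ge 2$, and let $S_1,\dots,S_k:\mathbb{R}^d\to\mathbb{R}^d$ be similitudes, $|S_i(x)-S_i(y)|=\alpha_i|x-y|$ with $0<\alpha_i<1$ (Euclidean norm), satisfying the open set condition: there is a nonempty open set $U$ with $S_i(U)\subset U$ for all $i$ and $S_i(U)\cap S_j(U)=\emptyset$ for $i\ne j$. Let $K$ be the associated self-similar set, i.e. the nonempty compact set with $K=\bigcup_i S_i(K)$, and let $s$ be the real number with $\sum_{i=1}^k\alpha_i^s=1$. For a finite word $\mathbf i=i_1\cdots i_n$ put $S_{\mathbf i}=S_{i_1}\circ\cdots\circ S_{i_n}$, $K_{\mathbf i}=S_{\mathbf i}(K)$, $\alpha_{\mathbf i}=\alpha_{i_1}\cdots\alpha_{i_n}$, and let $I(R)$ be the set of nonempty words with $\alpha_{i_1\cdots i_n}\le R<\alpha_{i_1\cdots i_{n-1}}$ (the empty word having ratio $1$). Let $\mathcal M(K)$ be the space of Borel probability measures on $K$ with the weak topology, and let $\varrho(\mu,\nu)=\sup|\int f\,d\mu-\int f\,d\nu|$, the supremum being over all $f:K\to\mathbb R$ with $\sup|f|\le 1$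 and Lipschitz constant at most $1$. Let $(\nu_n)$ be a dense sequence in $\mathcal M(K)$, let $(J_n)$ be a strictly increasing sequence of nonnegative integers with $J_n/n\to\infty$, and for every $n\ge1$ and $\mathbf i\in I(2^{-J_n})$ choose a centre $x_{\mathbf i}=x_{n,\mathbf i}\in K_{\mathbf i}$. Put $$\lambda_n=\sum_{\mathbf i\in I(2^{-J_n})}\alpha_{\mathbf i}^s\,\delta_{x_{\mathbf i}},\qquad \beta_n=2^{-J_n/n},\qquad \mu_n=\beta_n\lambda_n+(1-\beta_n)\nu_n\qquad(n\ge 1),$$ $$\Omega''=\bigcap_{n\ge1}\ \bigcup_{l\ge n}\{\mu\in\mathcal M(K):\varrho(\mu,\mu_l)<2^{-sJ_l^2}\}.$$ Then $\dim_H K=s$, and $\Omega''$ is a dense $G_\delta$ set which is residual in $\mathcal M(K)$. For every $\mu\in\Omega''$ there is a strictly increasing sequence $(N_p)_{p\ge1}$ of positive integers with $$\varrho(\mu,\mu_{N_p})<2^{-sJ_{N_p}^2}\quad\text{for all }p\ge 1,$$ and for every such $\mu$, every such sequence $(N_p)$ and every real $\theta\ge1$ the following holds. Let $$\Lambda_\theta=\bigcap_{P\ge1}\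 \bigcup_{p\ge P}\ \bigcup_{\mathbf i\in I(2^{-J_{N_p}})}\overline B\bigl(x_{\mathbf i},2^{-\theta J_{N_p}}\bigr)\cap K .$$ There is a Borel probability measure $m_\theta$ with $m_\theta(A)=1$ for some Cantor set $A\subset\Lambda_\theta$ (a nonempty, compact, totally disconnected set without isolated points), and there are a constant $C>0$ and a sequence of positive numbers $(\eta_p)$, strictly decreasing to $0$, such that for every $p\ge2$ and every Borel set $B\subset\mathbb{R}^d$ with diameter $|B|\le\eta_p$, $$m_\theta(B)\le C\,|B|^{\frac s\theta-\frac{2}{p-1}}$$ (with the conventions $0^0=1$, and $0^a=+\infty$ for $a<0$). In particular $\dim_H m_\theta\ge s/\theta$, where $\dim_H m=\inf\{\dim_H E:E\subset K,\ m(E)>0\}$ and $m(E)$ denotes the outer measure when $E$ is not measurable. -/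

import Mathlib

open MeasureTheory Filter Topology
open scoped ENNReal

noncomputable section

/-- `d`-dimensional Euclidean space. -/
abbrev Euc (d : ℕ) : Type := EuclideanSpace ℝ (Fin d)

/-- The maps `S i` are contractive similitudes with ratios `α i`. -/
structure IsSimilitudeSystem {d k : ℕ} (S : Fin k → Euc d → Euc d) (α : Fin k → ℝ) : Prop where
  ratio_pos : ∀ i, 0 < α i
  ratio_lt_one : ∀ i, α i < 1
  dist_map : ∀ i x y, dist (S i x) (S i y) = α i * dist x y

/-- The self-similar set of the system `S`: the nonempty compact set `K` that is the union of its
images. -/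
structure IsSelfSimilarSet {d k : ℕ} (S : Fin k → Euc d → Euc d) (K : Set (Euc d)) : Prop where
  isCompact : IsCompact K
  nonempty : K.Nonempty
  eq_iUnion : K = ⋃ i, S i '' K

/-- The open set condition. -/
def OpenSetCondition {d k : ℕ} (S : Fin k → Euc d → Euc d) : Prop :=
  ∃ U : Set (Euc d), IsOpen U ∧ U.Nonempty ∧ (∀ i, S i '' U ⊆ U) ∧
    ∀ i j, i ≠ j → Disjoint (S i '' U) (S j '' U)

/-- `S_𝐢 = S_{i₁} ∘ ⋯ ∘ S_{iₙ}` for a finite word `𝐢 = i₁ ⋯ iₙ`. -/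
def wordMap {d k : ℕ} (S : Fin k → Euc d → Euc d) (w : List (Fin k)) : Euc d → Euc d :=
  w.foldr (fun i g => S i ∘ g) id

/-- `α_𝐢 = α_{i₁} ⋯ α_{iₙ}`. -/
def wordRatio {k : ℕ} (α : Fin k → ℝ) (w : List (Fin k)) : ℝ :=
  (w.map α).prod

/-- `I(R)`: the nonempty words `𝐢 = i₁ ⋯ iₙ` with `α_𝐢 ≤ R < α_{i₁ ⋯ iₙ₋₁}`. -/
def cutWords {k : ℕ} (α : Fin k → ℝ) (R : ℝ) : Set (List (Fin k)) :=
  {w | w ≠ [] ∧ wordRatio α w ≤ R ∧ R < wordRatio α w.dropLast}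

/-- The distance `ϱ`: the supremum of `|∫ f dμ - ∫ f dν|` over all `f` with Lipschitz constant at
most `1` and `sup |f| ≤ 1`. -/
def lipDist {X : Type*} [MetricSpace X] [MeasurableSpace X] (μ ν : Measure X) : ℝ :=
  sSup {r : ℝ | ∃ f : X → ℝ, LipschitzWith 1 f ∧ (∀ x, |f x| ≤ 1) ∧
    r = |∫ x, f x ∂μ - ∫ x, f x ∂ν|}

/-- `λₙ`: the sum of `α_𝐢 ^ s • δ_{x_𝐢}` over `𝐢 ∈ I(2^{-Jₙ})`, where `x n 𝐢` is the centre
chosen in `K_𝐢`. -/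
def atomicMeasure {d k : ℕ} {K : Set (Euc d)} (α : Fin k → ℝ) (s : ℝ) (J : ℕ → ℕ)
    (x : ℕ → List (Fin k) → K) (n : ℕ) : Measure K :=
  Measure.sum fun w : cutWords α ((2 : ℝ) ^ (-(J n : ℝ))) =>
    ENNReal.ofReal (wordRatio α w.1 ^ s) • Measure.dirac (x n w.1)

/-- `βₙ = 2^{-Jₙ/n}`. -/
def mixWeight (J : ℕ → ℕ) (n : ℕ) : ℝ :=
  (2 : ℝ) ^ (-((J n : ℝ) / (n : ℝ)))

/-- `μₙ = βₙ λₙ + (1 - βₙ) νₙ`. -/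
def mixMeasure {d k : ℕ} {K : Set (Euc d)} (α : Fin k → ℝ) (s : ℝ) (J : ℕ → ℕ)
    (x : ℕ → List (Fin k) → K) (ν : ℕ → ProbabilityMeasure K) (n : ℕ) : Measure K :=
  ENNReal.ofReal (mixWeight J n) • atomicMeasure α s J x n +
    ENNReal.ofReal (1 - mixWeight J n) • (ν n : Measure K)

/-- The set `⋂_{n ≥ 1} ⋃_{k ≥ n} B_ϱ(μₖ, 2^{-s Jₖ²})` of typical measures. -/
def typicalSet {d k : ℕ} {K : Set (Euc d)} (α : Fin k → ℝ) (s : ℝ) (J : ℕ → ℕ)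
    (x : ℕ → List (Fin k) → K) (ν : ℕ → ProbabilityMeasure K) : Set (ProbabilityMeasure K) :=
  ⋂ n ≥ 1, ⋃ l ≥ n, {μ : ProbabilityMeasure K |
    lipDist (μ : Measure K) (mixMeasure α s J x ν l) < (2 : ℝ) ^ (-(s * (J l : ℝ) ^ 2))}

/-- `(N_p)_{p ≥ 1}` is a strictly increasing sequence with `ϱ(μ, μ_{N_p}) < 2^{-s J_{N_p}²}` for
all `p ≥ 1`; the value `N 0` plays no role. -/
def IsApproxSeq {d k : ℕ} {K : Set (Euc d)} (α : Fin k → ℝ) (s : ℝ) (J : ℕ → ℕ)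
    (x : ℕ → List (Fin k) → K) (ν : ℕ → ProbabilityMeasure K) (μ : ProbabilityMeasure K)
    (N : ℕ → ℕ) : Prop :=
  StrictMono N ∧ ∀ p ≥ 1, lipDist (μ : Measure K) (mixMeasure α s J x ν (N p)) <
    (2 : ℝ) ^ (-(s * (J (N p) : ℝ) ^ 2))

/-- `Λ_{θ,p}`: the points of `K` at distance at most `2^{-θ J_{N_p}}` from one of the centres
`x_𝐢`, `𝐢 ∈ I(2^{-J_{N_p}})`. -/
def approxLevel {d k : ℕ} {K : Set (Euc d)} (α : Fin k → ℝ) (J : ℕ → ℕ)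
    (x : ℕ → List (Fin k) → K) (N : ℕ → ℕ) (θ : ℝ) (p : ℕ) : Set (Euc d) :=
  ⋃ w ∈ cutWords α ((2 : ℝ) ^ (-(J (N p) : ℝ))),
    Metric.closedBall (x (N p) w : Euc d) ((2 : ℝ) ^ (-(θ * (J (N p) : ℝ)))) ∩ K

/-- `Λ_θ = ⋂_{P ≥ 1} ⋃_{p ≥ P} Λ_{θ,p}`. -/
def approxSet {d k : ℕ} {K : Set (Euc d)} (α : Fin k → ℝ) (J : ℕ → ℕ)
    (x : ℕ → List (Fin k) → K) (N : ℕ → ℕ) (θ : ℝ) : Set (Euc d) :=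
  ⋂ P ≥ 1, ⋃ p ≥ P, approxLevel α J x N θ p

/-- A Cantor set: nonempty, compact, without isolated points and totally disconnected. -/
structure IsCantorSet {d : ℕ} (A : Set (Euc d)) : Prop where
  nonempty : A.Nonempty
  isCompact : IsCompact A
  preperfect : Preperfect A
  isTotallyDisconnected : IsTotallyDisconnected A

/-- The Hausdorff dimension of a measure `m` on `K`: the infimum of `dim_H A` over `A ⊆ K` with
`m A > 0`. -/
def measureDimH {d : ℕ} (K : Set (Euc d)) (m : Measure (Euc d)) : ℝ≥0∞ :=
  ⨅ (A : Set (Euc d)) (_ : A ⊆ K) (_ : 0 < m A), dimH A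

end

/-!
The topological half is a Baire category argument. The space `𝓜(K)` of probability measures is
compact and Hausdorff, hence Baire, the balls of `lipDist` are open in the weak topology
(`isOpen_lipDist_lt`, an application of the Arzelà-Ascoli theorem), and since `βₗ → 0` the measures
`μₗ`, `l ≥ n`, accumulate wherever the measures `νₗ` do (`tendsto_mix`). That happens everywhere,
because `𝓜(K)` has no isolated points (`isGδ_and_dense_typicalSet`).

The Cantor measures are built for an arbitrary strictly increasing sequence `N`. Write
`R p = 2 ^ (-J (N p))`. Choose a very sparse subsequence `R (φ j)` and a
random sequence of letters as follows: at the scales between `R (φ j) ^ θ` and `R (φ j)` the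
letters follow the code of the centre `x_v` of the current word
`v ∈ I(R (φ j))`, and at all other scales they are independent with probabilities `α i ^ s`
(`exists_forced_measure`). Such a measure on sequences exists by the Ionescu-Tulcea theorem
(`exists_treeMeasure`). Its image under the coding map is carried by
points that are within `R (φ j) ^ θ` of a centre, for every `j`. The mass of a word `w` is
`wordRatio α w ^ s` as long as no letter is prescribed, and prescribing the letters between two
scales costs at most a power of their quotient (`mass_le_of_free_scales`). By the open set
condition a ball of radius `2R` meets a bounded number of the sets `K_v`, `v ∈ I(R)`
(`exists_card_cutWords_le`), so the mass of a set of diameter `ρ ∈ [R (φ (j + 1)), R (φ j)]` is at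
most a constant times `ρ ^ (s / θ - 1 / (j + 1))`; the scales are so sparse that all the costs
before stage `j` are absorbed in `R (φ j) ^ (-1 / (j + 1))`
(`exists_measure_on_centres`).

An atomless measure charges a Cantor subset of each set that it charges
(`exists_isCantorSet_subset`), and the estimate survives the restriction to that subset. The bound
on the dimension of the measure is the mass distribution principle (`le_dimH_of_measure_le`), and
the case `θ = 1` of it is also the lower bound for `dimH K`; the upper bound comes from
the covers by the sets `K_w` with `w` of length `n`.
-/

/-! ### Words and initial segments of sequences -/

section Words

variable {k : ℕ}

/-- The word formed by the first `n` letters of the sequence `ω`. -/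
def initWord (ω : ℕ → Fin k) (n : ℕ) : List (Fin k) :=
  List.ofFn fun i : Fin n => ω i

@[simp] lemma length_initWord (ω : ℕ → Fin k) (n : ℕ) : (initWord ω n).length = n := by
  simp [initWord]

@[simp] lemma initWord_zero (ω : ℕ → Fin k) : initWord ω 0 = [] := by
  simp [initWord]

lemma initWord_succ (ω : ℕ → Fin k) (n : ℕ) : initWord ω (n + 1) = initWord ω n ++ [ω n] := by
  rw [initWord, List.ofFn_succ_last]
  simp [initWord]

lemma initWord_succ_cons (ω : ℕ → Fin k) (n : ℕ) :
    initWord ω (n + 1) = ω 0 :: initWord (fun m => ω (m + 1)) n := by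
  simp [initWord, List.ofFn_succ]

lemma initWord_congr {ω τ : ℕ → Fin k} {n : ℕ} (h : ∀ i < n, ω i = τ i) :
    initWord ω n = initWord τ n := by
  simp only [initWord]
  congr 1
  funext i
  exact h i i.2

lemma initWord_eq_iff {ω τ : ℕ → Fin k} {n : ℕ} :
    initWord ω n = initWord τ n ↔ ∀ i < n, ω i = τ i := by
  refine ⟨fun h i hi => ?_, initWord_congr⟩
  have := List.ofFn_injective h
  exact congrFun this ⟨i, hi⟩

lemma take_initWord (ω : ℕ → Fin k) {m n : ℕ} (h : m ≤ n) :
    (initWord ω n).take m = initWord ω m := by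
  induction n, h using Nat.le_induction with
  | base => simp [List.take_of_length_le]
  | succ n hn ih => rw [initWord_succ, List.take_append_of_le_length (by simpa using hn), ih]

lemma exists_initWord_eq (hk : 0 < k) (w : List (Fin k)) :
    ∃ ω : ℕ → Fin k, initWord ω w.length = w := by
  refine ⟨fun n => w.getD n ⟨0, hk⟩, ?_⟩
  apply List.ext_getElem
  · simp
  · intro i h1 h2
    simp [initWord]

@[simp] lemma wordRatio_nil (α : Fin k → ℝ) : wordRatio α [] = 1 := by simp [wordRatio]

lemma wordRatio_append (α : Fin k → ℝ) (v w : List (Fin k)) :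
    wordRatio α (v ++ w) = wordRatio α v * wordRatio α w := by
  simp [wordRatio]

lemma wordRatio_cons (α : Fin k → ℝ) (i : Fin k) (w : List (Fin k)) :
    wordRatio α (i :: w) = α i * wordRatio α w := by
  simp [wordRatio]

lemma wordRatio_initWord_succ (α : Fin k → ℝ) (ω : ℕ → Fin k) (n : ℕ) :
    wordRatio α (initWord ω (n + 1)) = wordRatio α (initWord ω n) * α (ω n) := by
  rw [initWord_succ, wordRatio_append]
  simp [wordRatio]

variable {α : Fin k → ℝ}

lemma wordRatio_pos (h0 : ∀ i, 0 < α i) (w : List (Fin k)) : 0 < wordRatio α w := by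
  induction w with
  | nil => simp
  | cons i w ih => rw [wordRatio_cons]; exact mul_pos (h0 i) ih

lemma wordRatio_le_one (h0 : ∀ i, 0 < α i) (h1 : ∀ i, α i < 1) (w : List (Fin k)) :
    wordRatio α w ≤ 1 := by
  induction w with
  | nil => simp
  | cons i w ih =>
    rw [wordRatio_cons]
    exact mul_le_one₀ (h1 i).le (wordRatio_pos h0 w).le ih

lemma wordRatio_le_of_prefix (h0 : ∀ i, 0 < α i) (h1 : ∀ i, α i < 1) {v w : List (Fin k)}
    (h : v <+: w) : wordRatio α w ≤ wordRatio α v := by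
  obtain ⟨t, rfl⟩ := h
  rw [wordRatio_append]
  exact mul_le_of_le_one_right (wordRatio_pos h0 v).le (wordRatio_le_one h0 h1 t)

lemma antitone_wordRatio_initWord (h0 : ∀ i, 0 < α i) (h1 : ∀ i, α i < 1) (ω : ℕ → Fin k) :
    Antitone fun n => wordRatio α (initWord ω n) := by
  refine antitone_nat_of_succ_le fun n => ?_
  rw [wordRatio_initWord_succ]
  exact mul_le_of_le_one_right (wordRatio_pos h0 _).le (h1 _).le

lemma exists_ratio_bounds (h0 : ∀ i, 0 < α i) (h1 : ∀ i, α i < 1) :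
    ∃ a b : ℝ, 0 < a ∧ a < 1 ∧ 0 < b ∧ b < 1 ∧ (∀ i, a ≤ α i) ∧ ∀ i, α i ≤ b := by
  rcases isEmpty_or_nonempty (Fin k) with h | h
  · exact ⟨1 / 2, 1 / 2, by norm_num, by norm_num, by norm_num, by norm_num, fun i => h.elim i,
      fun i => h.elim i⟩
  · obtain ⟨i, hi⟩ := Finite.exists_min α
    obtain ⟨j, hj⟩ := Finite.exists_max α
    exact ⟨α i, α j, h0 i, h1 i, h0 j, h1 j, hi, hj⟩

lemma tendsto_wordRatio_initWord (h0 : ∀ i, 0 < α i) (h1 : ∀ i, α i < 1) (ω : ℕ → Fin k) :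
    Tendsto (fun n => wordRatio α (initWord ω n)) atTop (𝓝 0) := by
  obtain ⟨a, b, -, -, hb0, hb1, -, hb⟩ := exists_ratio_bounds h0 h1
  refine squeeze_zero (fun n => (wordRatio_pos h0 _).le) (fun n => ?_)
    (tendsto_pow_atTop_nhds_zero_of_lt_one hb0.le hb1)
  induction n with
  | zero => simp
  | succ n ih =>
    rw [wordRatio_initWord_succ, pow_succ]
    exact mul_le_mul ih (hb _) (h0 _).le ((wordRatio_pos h0 _).le.trans ih)

/-! ### Cutting words at a given scale -/

lemma initWord_mem_cutWords_iff {R : ℝ} {ω : ℕ → Fin k} {n : ℕ} :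
    initWord ω (n + 1) ∈ cutWords α R ↔
      wordRatio α (initWord ω (n + 1)) ≤ R ∧ R < wordRatio α (initWord ω n) := by
  have : (initWord ω (n + 1)).dropLast = initWord ω n := by rw [initWord_succ]; simp
  simp only [cutWords, Set.mem_ofPred_eq, this]
  simp [initWord_succ]

/-- Every sequence has an initial segment in `I(R)`, for `0 < R < 1`. -/
lemma exists_initWord_mem_cutWords (h0 : ∀ i, 0 < α i) (h1 : ∀ i, α i < 1) {R : ℝ} (hR : 0 < R)
    (hR1 : R < 1) (ω : ℕ → Fin k) : ∃ n, initWord ω (n + 1) ∈ cutWords α R := by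
  classical
  have hex : ∃ n, wordRatio α (initWord ω n) ≤ R :=
    ((tendsto_wordRatio_initWord h0 h1 ω).eventually (ge_mem_nhds hR)).exists
  have h := Nat.find_spec hex
  obtain ⟨m, hm⟩ : ∃ m, Nat.find hex = m + 1 := by
    refine Nat.exists_eq_succ_of_ne_zero fun h' => ?_
    rw [h'] at h
    simp at h
    linarith
  rw [hm] at h
  refine ⟨m, initWord_mem_cutWords_iff.2 ⟨h, ?_⟩⟩
  exact not_le.1 (Nat.find_min hex (m := m) (by omega))

/-- The initial segment of a sequence that lies in `I(R)` is unique. -/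
lemma initWord_mem_cutWords_unique (h0 : ∀ i, 0 < α i) (h1 : ∀ i, α i < 1) {R : ℝ}
    {ω : ℕ → Fin k} {m n : ℕ} (hm : initWord ω (m + 1) ∈ cutWords α R)
    (hn : initWord ω (n + 1) ∈ cutWords α R) : m = n := by
  rw [initWord_mem_cutWords_iff] at hm hn
  have hA := antitone_wordRatio_initWord h0 h1 ω
  by_contra hne
  rcases lt_or_gt_of_ne hne with h | h
  · have := hA (show m + 1 ≤ n from h); simp only at this; linarith
  · have := hA (show n + 1 ≤ m from h); simp only at this; linarith

lemma exists_eq_initWord_of_mem_cutWords (hk : 0 < k) {R : ℝ} {w : List (Fin k)}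
    (hw : w ∈ cutWords α R) : ∃ (ω : ℕ → Fin k) (n : ℕ), w = initWord ω (n + 1) := by
  obtain ⟨ω, hω⟩ := exists_initWord_eq hk w
  obtain ⟨n, hn⟩ : ∃ n, w.length = n + 1 :=
    Nat.exists_eq_succ_of_ne_zero (by simpa using hw.1)
  exact ⟨ω, n, by rw [← hn, hω]⟩

lemma lt_wordRatio_of_mem_cutWords (hk : 0 < k) {a : ℝ} (ha : 0 < a) (hα : ∀ i, a ≤ α i) {R : ℝ}
    {w : List (Fin k)} (hw : w ∈ cutWords α R) : a * R < wordRatio α w := by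
  obtain ⟨ω, n, rfl⟩ := exists_eq_initWord_of_mem_cutWords hk hw
  have h := (initWord_mem_cutWords_iff.1 hw).2
  rw [wordRatio_initWord_succ]
  have := hα (ω n)
  have hpos : 0 < wordRatio α (initWord ω n) := wordRatio_pos (fun i => ha.trans_le (hα i)) _
  nlinarith

lemma eq_of_prefix_of_mem_cutWords (h0 : ∀ i, 0 < α i) (h1 : ∀ i, α i < 1) {R : ℝ}
    {v w : List (Fin k)} (hv : v ∈ cutWords α R) (hw : w ∈ cutWords α R) (h : v <+: w) :
    v = w := by
  by_contra hne
  have h' : v <+: w.dropLast := by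
    refine List.prefix_of_prefix_length_le h (List.dropLast_prefix w) ?_
    have : v.length < w.length :=
      lt_of_le_of_ne h.length_le fun he => hne (h.eq_of_length he)
    simp
    omega
  have := wordRatio_le_of_prefix h0 h1 h'
  linarith [hv.2.1, hw.2.2]

end Words

/-! ### The system of similitudes and the coding map -/

section Coding

variable {d k : ℕ} {S : Fin k → Euc d → Euc d} {α : Fin k → ℝ} {K : Set (Euc d)}

lemma wordMap_cons (i : Fin k) (w : List (Fin k)) (x : Euc d) :
    wordMap S (i :: w) x = S i (wordMap S w x) := by
  simp [wordMap]

lemma wordMap_append (v w : List (Fin k)) (x : Euc d) :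
    wordMap S (v ++ w) x = wordMap S v (wordMap S w x) := by
  induction v with
  | nil => simp [wordMap]
  | cons i v ih => rw [List.cons_append, wordMap_cons, wordMap_cons, ih]

lemma IsSimilitudeSystem.dist_wordMap (hS : IsSimilitudeSystem S α) (w : List (Fin k))
    (x y : Euc d) : dist (wordMap S w x) (wordMap S w y) = wordRatio α w * dist x y := by
  induction w with
  | nil => simp [wordMap]
  | cons i w ih => rw [wordMap_cons, wordMap_cons, hS.dist_map, ih, wordRatio_cons, mul_assoc]

lemma IsSimilitudeSystem.continuous_wordMap (hS : IsSimilitudeSystem S α) (w : List (Fin k)) :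
    Continuous (wordMap S w) := by
  refine (LipschitzWith.of_dist_le_mul (K := (wordRatio α w).toNNReal) fun x y => ?_).continuous
  rw [hS.dist_wordMap, Real.coe_toNNReal _ (wordRatio_pos hS.ratio_pos w).le]

lemma IsSimilitudeSystem.injective (hS : IsSimilitudeSystem S α) (i : Fin k) :
    Function.Injective (S i) := by
  intro x y h
  have := hS.dist_map i x y
  rw [h, dist_self, eq_comm, mul_eq_zero] at this
  exact dist_eq_zero.1 (this.resolve_left (hS.ratio_pos i).ne')

lemma IsSelfSimilarSet.image_subset (hK : IsSelfSimilarSet S K) (i : Fin k) : S i '' K ⊆ K := by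
  conv_rhs => rw [hK.eq_iUnion]
  exact Set.subset_iUnion (fun i => S i '' K) i

lemma IsSelfSimilarSet.wordMap_image_subset (hK : IsSelfSimilarSet S K) (w : List (Fin k)) :
    wordMap S w '' K ⊆ K := by
  induction w with
  | nil => simp [wordMap]
  | cons i w ih =>
    rintro _ ⟨x, hx, rfl⟩
    rw [wordMap_cons]
    exact hK.image_subset i ⟨_, ih ⟨x, hx, rfl⟩, rfl⟩

lemma IsSelfSimilarSet.wordMap_append_image_subset (hK : IsSelfSimilarSet S K)
    (v w : List (Fin k)) : wordMap S (v ++ w) '' K ⊆ wordMap S v '' K := by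
  rintro _ ⟨x, hx, rfl⟩
  exact ⟨wordMap S w x, hK.wordMap_image_subset w ⟨x, hx, rfl⟩, (wordMap_append v w x).symm⟩

lemma IsSimilitudeSystem.dist_le_of_mem_image (hS : IsSimilitudeSystem S α) (hK : IsCompact K)
    (w : List (Fin k)) {x y : Euc d} (hx : x ∈ wordMap S w '' K) (hy : y ∈ wordMap S w '' K) :
    dist x y ≤ wordRatio α w * Metric.diam K := by
  obtain ⟨x, hx, rfl⟩ := hx
  obtain ⟨y, hy, rfl⟩ := hy
  rw [hS.dist_wordMap]
  exact mul_le_mul_of_nonneg_left (Metric.dist_le_diam_of_mem hK.isBounded hx hy)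
    (wordRatio_pos hS.ratio_pos w).le

lemma exists_mem_forall_image_initWord (hS : IsSimilitudeSystem S α) (hK : IsSelfSimilarSet S K)
    (ω : ℕ → Fin k) : ∃ x, ∀ n, x ∈ wordMap S (initWord ω n) '' K := by
  have hc : ∀ n, IsCompact (wordMap S (initWord ω n) '' K) := fun n =>
    hK.isCompact.image (hS.continuous_wordMap _)
  have := IsCompact.nonempty_iInter_of_sequence_nonempty_isCompact_isClosed
    (fun n => wordMap S (initWord ω n) '' K)
    (fun n => by rw [initWord_succ]; exact hK.wordMap_append_image_subset _ _)
    (fun n => hK.nonempty.image _) (hc 0) (fun n => (hc n).isClosed)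
  obtain ⟨x, hx⟩ := this
  exact ⟨x, fun n => Set.mem_iInter.1 hx n⟩

/-- The coding map: `coding S K ω` is the point common to all the sets `K_{ω₁ ⋯ ωₙ}`. -/
noncomputable def coding (S : Fin k → Euc d → Euc d) (K : Set (Euc d)) (ω : ℕ → Fin k) : Euc d :=
  Classical.epsilon fun x => ∀ n, x ∈ wordMap S (initWord ω n) '' K

lemma coding_mem (hS : IsSimilitudeSystem S α) (hK : IsSelfSimilarSet S K) (ω : ℕ → Fin k)
    (n : ℕ) : coding S K ω ∈ wordMap S (initWord ω n) '' K :=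
  Classical.epsilon_spec (exists_mem_forall_image_initWord hS hK ω) n

lemma coding_mem_set (hS : IsSimilitudeSystem S α) (hK : IsSelfSimilarSet S K)
    (ω : ℕ → Fin k) : coding S K ω ∈ K :=
  hK.wordMap_image_subset _ (coding_mem hS hK ω 0)

lemma continuous_coding (hS : IsSimilitudeSystem S α) (hK : IsSelfSimilarSet S K) :
    Continuous (coding S K) := by
  rw [continuous_iff_continuousAt]
  intro ω
  rw [ContinuousAt, Metric.tendsto_nhds]
  intro ε hε
  have ht : Tendsto (fun n => wordRatio α (initWord ω n) * Metric.diam K) atTop (𝓝 0) := by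
    simpa using (tendsto_wordRatio_initWord hS.ratio_pos hS.ratio_lt_one ω).mul_const _
  obtain ⟨n, hn⟩ := (ht.eventually (gt_mem_nhds hε)).exists
  have hcyl : ∀ᶠ τ in 𝓝 ω, ∀ i ∈ Set.Iio n, τ i = ω i := by
    rw [(Set.finite_Iio n).eventually_all]
    intro i _
    have := (continuous_apply i : Continuous fun τ : ℕ → Fin k => τ i).tendsto ω
    exact this.eventually (p := fun j => j = ω i) (by simp [nhds_discrete])
  filter_upwards [hcyl] with τ hτ
  have h := coding_mem hS hK τ n
  rw [initWord_congr (τ := ω) hτ] at h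
  exact (hS.dist_le_of_mem_image hK.isCompact _ h (coding_mem hS hK ω n)).trans_lt hn

/-- Every point of `K_v` has a code that starts with `v`. -/
lemma exists_code_of_mem (hK : IsSelfSimilarSet S K)
    (v : List (Fin k)) {x : Euc d} (hx : x ∈ wordMap S v '' K) :
    ∃ ω : ℕ → Fin k, initWord ω v.length = v ∧ ∀ n, x ∈ wordMap S (initWord ω n) '' K := by
  induction v generalizing x with
  | nil =>
    have hstep : ∀ y : K, ∃ (i : Fin k) (y' : K), S i y' = y := by
      intro y
      have hy : (y : Euc d) ∈ ⋃ i, S i '' K := hK.eq_iUnion ▸ y.2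
      obtain ⟨i, y', hy', h⟩ := Set.mem_iUnion.1 hy
      exact ⟨i, ⟨y', hy'⟩, h⟩
    choose e g hg using hstep
    have hxK : x ∈ K := by simpa [wordMap] using hx
    let y : ℕ → K := fun n => g^[n] ⟨x, hxK⟩
    refine ⟨fun n => e (y n), by simp, fun n => ⟨y n, (y n).2, ?_⟩⟩
    induction n with
    | zero => simp [wordMap, y]
    | succ n ih =>
      rw [initWord_succ, wordMap_append, wordMap_cons]
      simp only [wordMap, List.foldr_nil, id_eq]
      have : (y (n + 1) : Euc d) = g (y n) := by simp [y, Function.iterate_succ_apply']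
      rw [this, hg]
      exact ih
  | cons i v ih =>
    obtain ⟨y, hy, rfl⟩ := hx
    rw [wordMap_cons]
    obtain ⟨ω, hω, h⟩ := ih ⟨y, hy, rfl⟩
    refine ⟨fun n => Nat.casesOn n i ω, ?_, fun n => ?_⟩
    · rw [List.length_cons, initWord_succ_cons]
      exact congrArg _ hω
    · cases n with
      | zero =>
        obtain ⟨z, hz, he⟩ := h 0
        exact ⟨_, hK.image_subset i ⟨z, hz, rfl⟩, by simpa [wordMap] using congrArg (S i) he⟩
      | succ n =>
        rw [initWord_succ_cons]
        obtain ⟨z, hz, he⟩ := h n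
        exact ⟨z, hz, by rw [wordMap_cons]; exact congrArg (S i) he⟩

/-! ### Counting cylinders under the open set condition -/

lemma disjoint_wordMap_image (hS : IsSimilitudeSystem S α) {U : Set (Euc d)}
    (hU : ∀ i, S i '' U ⊆ U) (hd : ∀ i j, i ≠ j → Disjoint (S i '' U) (S j '' U))
    {v w : List (Fin k)} (hvw : ¬ v <+: w) (hwv : ¬ w <+: v) :
    Disjoint (wordMap S v '' U) (wordMap S w '' U) := by
  have hsub : ∀ w : List (Fin k), wordMap S w '' U ⊆ U := by
    intro w
    induction w with
    | nil => simp [wordMap]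
    | cons i w ih =>
      rintro _ ⟨x, hx, rfl⟩
      rw [wordMap_cons]
      exact hU i ⟨_, ih ⟨x, hx, rfl⟩, rfl⟩
  induction v generalizing w with
  | nil => simp at hvw
  | cons i v ih =>
    cases w with
    | nil => simp at hwv
    | cons j w =>
      have himg : ∀ (i : Fin k) (v : List (Fin k)),
          wordMap S (i :: v) '' U = S i '' (wordMap S v '' U) := by
        intro i v
        rw [Set.image_image]
        simp only [wordMap_cons]
      rw [himg, himg]
      by_cases hij : i = j
      · subst hij
        rw [Set.disjoint_image_iff (hS.injective i)]
        exact ih (fun h => hvw (by simpa using h)) (fun h => hwv (by simpa using h))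
      · exact (hd i j hij).mono (Set.image_mono (hsub v)) (Set.image_mono (hsub w))

/-- Under the open set condition, a ball of radius `2R` meets a bounded number of the sets `K_v`,
`v ∈ I(R)`: it is a volume comparison of the ball with the disjoint copies `S_v(B)` of a small ball
`B` in the open set. The volume is the `d`-dimensional Hausdorff measure, for which the effect of a
similitude is immediate. -/
lemma exists_card_cutWords_le (hk : 0 < k) (hS : IsSimilitudeSystem S α) (hU : OpenSetCondition S)
    (hK : IsCompact K) :
    ∃ M : ℕ, ∀ R : ℝ, 0 < R → ∀ (x : Euc d) (F : Finset (List (Fin k))),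
      (∀ v ∈ F, v ∈ cutWords α R ∧ (wordMap S v '' K ∩ Metric.ball x (2 * R)).Nonempty) →
        F.card ≤ M := by
  obtain ⟨U, hUo, ⟨y₀, hy₀⟩, hUS, hUd⟩ := hU
  obtain ⟨ε, hε, hεU⟩ := Metric.nhds_basis_closedBall.mem_iff.1 (hUo.mem_nhds hy₀)
  obtain ⟨a, b, ha, -, -, -, haα, -⟩ := exists_ratio_bounds hS.ratio_pos hS.ratio_lt_one
  obtain ⟨D, hD0, hD⟩ : ∃ D > 0, K ⊆ Metric.closedBall y₀ D := by
    obtain ⟨D, hD⟩ := hK.isBounded.subset_closedBall y₀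
    exact ⟨max D 1, by positivity, hD.trans (Metric.closedBall_subset_closedBall (le_max_left _ _))⟩
  set n := Module.finrank ℝ (Euc d) with hn
  let μ : Measure (Euc d) := μH[n]
  have : μ.IsAddHaarMeasure := isAddHaarMeasure_hausdorffMeasure
  set C := ε + D + 2 with hC
  obtain ⟨M, hM⟩ := exists_nat_ge ((C / (a * ε)) ^ n)
  refine ⟨M, fun R hR x F hF => ?_⟩
  let T : List (Fin k) → Set (Euc d) := fun v => wordMap S v '' Metric.closedBall y₀ ε
  have hTc : ∀ v, IsCompact (T v) := fun v =>
    (isCompact_closedBall _ _).image (hS.continuous_wordMap v)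
  have hdisj : (F : Set (List (Fin k))).PairwiseDisjoint T := by
    intro v hv w hw hvw
    refine (disjoint_wordMap_image hS hUS hUd (fun h => hvw ?_) (fun h => hvw ?_)).mono
      (Set.image_mono hεU) (Set.image_mono hεU)
    · exact eq_of_prefix_of_mem_cutWords hS.ratio_pos hS.ratio_lt_one (hF v hv).1 (hF w hw).1 h
    · exact (eq_of_prefix_of_mem_cutWords hS.ratio_pos hS.ratio_lt_one (hF w hw).1
        (hF v hv).1 h).symm
  have hsub : (⋃ v ∈ F, T v) ⊆ Metric.closedBall x (C * R) := by
    intro z hz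
    simp only [Set.mem_iUnion] at hz
    obtain ⟨v, hv, y, hy, rfl⟩ := hz
    obtain ⟨hvR, _, ⟨p, hp, rfl⟩, hpx⟩ := hF v hv
    rw [Metric.mem_closedBall] at hy ⊢
    have h1 : dist p y₀ ≤ D := hD hp
    have h2 : dist y p ≤ ε + D := (dist_triangle_right y p y₀).trans (add_le_add hy h1)
    have h3 : dist (wordMap S v y) (wordMap S v p) ≤ R * (ε + D) := by
      rw [hS.dist_wordMap]
      exact mul_le_mul hvR.2.1 h2 dist_nonneg hR.le
    have h4 := dist_triangle (wordMap S v y) (wordMap S v p) x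
    rw [Metric.mem_ball] at hpx
    rw [hC]
    linarith
  have hlow : ∀ v ∈ F, ENNReal.ofReal ((a * R * ε) ^ n) * μ (Metric.ball 0 1) ≤ μ (T v) := by
    intro v hv
    have hpos := wordRatio_pos hS.ratio_pos v
    have hanti : AntilipschitzWith (wordRatio α v).toNNReal⁻¹ (wordMap S v) := by
      refine AntilipschitzWith.of_le_mul_dist fun y z => ?_
      rw [hS.dist_wordMap, NNReal.coe_inv, Real.coe_toNNReal _ hpos.le,
        inv_mul_cancel_left₀ hpos.ne']
    have h1 := hanti.le_hausdorffMeasure_image (d := (n : ℝ)) (by positivity)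
      (Metric.closedBall y₀ ε)
    change μ _ ≤ _ * μ (T v) at h1
    rw [Measure.addHaar_closedBall μ y₀ hε.le] at h1
    have hne : (((wordRatio α v).toNNReal⁻¹ : NNReal) : ℝ≥0∞) ^ (n : ℝ)
        = (ENNReal.ofReal (wordRatio α v ^ n))⁻¹ := by
      rw [ENNReal.rpow_natCast, ENNReal.coe_inv (by simpa using hpos), ← ENNReal.inv_pow,
        ENNReal.ofReal_pow hpos.le]
      rfl
    rw [hne] at h1
    have hpn : 0 < wordRatio α v ^ n := pow_pos hpos n
    have h2 : ENNReal.ofReal (wordRatio α v ^ n) *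
        (ENNReal.ofReal (ε ^ n) * μ (Metric.ball 0 1)) ≤ μ (T v) := by
      calc _ ≤ ENNReal.ofReal (wordRatio α v ^ n) *
            ((ENNReal.ofReal (wordRatio α v ^ n))⁻¹ * μ (T v)) := by gcongr
        _ = μ (T v) := by
          rw [← mul_assoc, ENNReal.mul_inv_cancel (by simpa using hpn) ENNReal.ofReal_ne_top,
            one_mul]
    refine le_trans ?_ h2
    rw [← mul_assoc, ← ENNReal.ofReal_mul hpn.le]
    gcongr
    rw [mul_pow]
    gcongr
    exact (lt_wordRatio_of_mem_cutWords hk ha haα (hF v hv).1).le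
  have hsum : (F.card : ℝ≥0∞) * (ENNReal.ofReal ((a * R * ε) ^ n) * μ (Metric.ball 0 1)) ≤
      ENNReal.ofReal ((C * R) ^ n) * μ (Metric.ball 0 1) := by
    rw [← Measure.addHaar_closedBall μ x (show 0 ≤ C * R by positivity)]
    refine le_trans ?_ (measure_mono (μ := μ) hsub)
    rw [measure_biUnion_finset hdisj fun v _ => (hTc v).isClosed.measurableSet, ← nsmul_eq_mul]
    exact Finset.card_nsmul_le_sum _ _ _ hlow
  rw [← mul_assoc, ENNReal.mul_le_mul_iff_left (Metric.measure_ball_pos μ _ one_pos).ne'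
    measure_ball_lt_top.ne, ← ENNReal.ofReal_natCast, ← ENNReal.ofReal_mul (by positivity),
    ENNReal.ofReal_le_ofReal_iff (by positivity)] at hsum
  have h5 : (F.card : ℝ) ≤ (C / (a * ε)) ^ n := by
    rw [div_pow, le_div_iff₀ (by positivity)]
    have h6 : (F.card : ℝ) * (a * ε) ^ n * R ^ n ≤ C ^ n * R ^ n := by
      calc _ = F.card * (a * R * ε) ^ n := by rw [mul_pow, mul_pow, mul_pow]; ring
        _ ≤ _ := by rw [← mul_pow]; exact hsum
    exact le_of_mul_le_mul_right h6 (by positivity)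
  exact_mod_cast h5.trans hM

end Coding

/-! ### Measures on the sequence space with prescribed transition probabilities -/

section TreeMeasure

variable {k : ℕ}

lemma measurableSet_cylinder (ω : ℕ → Fin k) (n : ℕ) : MeasurableSet (PiNat.cylinder ω n) := by
  exact (PiNat.isOpen_cylinder _ ω n).measurableSet

open ProbabilityTheory Finset Preorder in
/-- The Ionescu-Tulcea theorem for sequences of letters, where the law of the next letter is a
function `t` of the word formed by the previous letters. -/
lemma exists_treeMeasure (t : List (Fin k) → Fin k → ℝ≥0∞) (ht : ∀ w, ∑ i, t w i = 1) :
    ∃ P : Measure (ℕ → Fin k), IsProbabilityMeasure P ∧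
      ∀ ω n, P (PiNat.cylinder ω (n + 1)) = P (PiNat.cylinder ω n) * t (initWord ω n) (ω n) := by
  classical
  -- the law of the next letter, as a kernel on the trajectories up to time `n`
  let p : List (Fin k) → PMF (Fin k) := fun w => PMF.ofFintype (t w) (ht w)
  have hp : ∀ w i, (p w).toMeasure {i} = t w i := fun w i => by
    rw [PMF.toMeasure_apply_singleton _ _ (measurableSet_singleton _)]
    rfl
  let X : ℕ → Type := fun _ => Fin k
  let wd : (n : ℕ) → ((i : Iic n) → X i) → List (Fin k) := fun n y =>
    List.ofFn fun i : Fin (n + 1) => y ⟨i, by simp; omega⟩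
  have hwd : ∀ (ω : ℕ → Fin k) n, wd n (frestrictLe (π := X) n ω) = initWord ω (n + 1) :=
    fun ω n => rfl
  let κ : (n : ℕ) → Kernel ((i : Iic n) → X i) (X (n + 1)) := fun n =>
    Kernel.ofFunOfCountable fun y => (p (wd n y)).toMeasure
  have hκ : ∀ n, IsMarkovKernel (κ n) := fun n => ⟨fun y => by
    change IsProbabilityMeasure (p (wd n y)).toMeasure
    infer_instance⟩
  let P : Measure (ℕ → Fin k) := Kernel.trajMeasure (X := X) (p []).toMeasure κ
  have hP : IsProbabilityMeasure P :=
    inferInstanceAs (IsProbabilityMeasure (Kernel.trajMeasure _ κ))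
  have hcyl : ∀ (ω : ℕ → Fin k) n,
      PiNat.cylinder ω (n + 1) = frestrictLe (π := X) n ⁻¹' {frestrictLe (π := X) n ω} := by
    intro ω n
    ext τ
    simp only [PiNat.mem_cylinder_iff, Set.mem_preimage, Set.mem_singleton_iff]
    refine ⟨fun h => ?_, fun h i hi => ?_⟩
    · funext i
      exact h i (Nat.lt_succ_of_le (Finset.mem_Iic.1 i.2))
    · exact congrFun h ⟨i, by simp; omega⟩
  refine ⟨P, hP, fun ω n => ?_⟩
  cases n with
  | zero =>
    have h0 : P.map (frestrictLe (π := X) 0) =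
        (p []).toMeasure.map (MeasurableEquiv.piUnique (fun i : Iic 0 => X i)).symm := by
      change (Kernel.trajMeasure _ κ).map _ = _
      rw [Kernel.trajMeasure, Measure.map_comp _ _ (by fun_prop), Kernel.traj_map_frestrictLe,
        Kernel.partialTraj_self, Measure.id_comp]
    have h1 := congrArg (fun μ => μ {frestrictLe (π := X) 0 ω}) h0
    rw [Measure.map_apply (by fun_prop) (measurableSet_singleton _),
      Measure.map_apply (by fun_prop) (measurableSet_singleton _), ← hcyl] at h1
    rw [h1, PiNat.cylinder_zero, measure_univ, one_mul, initWord_zero, ← hp]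
    congr 1
    ext i
    simp only [Set.mem_preimage, Set.mem_singleton_iff]
    rw [MeasurableEquiv.symm_apply_eq]
    rfl
  | succ n =>
    have h := Kernel.map_frestrictLe_trajMeasure_compProd_eq_map_trajMeasure (X := X)
      (μ₀ := (p []).toMeasure) (κ := κ) (a := n)
    have h1 := congrArg (fun μ => μ ({frestrictLe (π := X) n ω} ×ˢ {ω (n + 1)})) h
    rw [Measure.compProd_apply_prod (measurableSet_singleton _) (measurableSet_singleton _),
      lintegral_singleton, Measure.map_apply (by fun_prop) (measurableSet_singleton _),
      Measure.map_apply (by fun_prop)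
        ((measurableSet_singleton _).prod (measurableSet_singleton _))] at h1
    have h2 : PiNat.cylinder ω (n + 1 + 1) =
        (fun x : (n : ℕ) → X n => (frestrictLe n x, x (n + 1))) ⁻¹'
        ({frestrictLe (π := X) n ω} ×ˢ {ω (n + 1)}) := by
      ext τ
      simp only [Set.mem_preimage, Set.mem_prod, Set.mem_singleton_iff]
      have h3 : frestrictLe (π := X) n τ = frestrictLe (π := X) n ω ↔
          τ ∈ PiNat.cylinder ω (n + 1) := by rw [hcyl]; rfl
      rw [h3]
      simp only [PiNat.mem_cylinder_iff]
      refine ⟨fun h => ⟨fun i hi => h i (by omega), h _ (by omega)⟩, fun h i hi => ?_⟩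
      rcases Nat.lt_succ_iff_lt_or_eq.1 hi with hi | rfl
      · exact h.1 i hi
      · exact h.2
    rw [h2]
    refine h1.symm.trans ?_
    rw [← hcyl, mul_comm]
    congr 1
    change (p (wd n (frestrictLe (π := X) n ω))).toMeasure {ω (n + 1)} = _
    rw [hp, hwd]

end TreeMeasure

/-! ### Mass of cylinders when the letters are prescribed on some ranges of scales -/

section MassBound

/-- Along a sequence of words with ratios `A n` and masses `f n`, suppose that the mass scales like
`A n ^ s` as long as `A n` is outside the intervals `(r j, R j]`. Crossing the interval `(r j, R j]`
then costs at most a factor `(R j / (a ^ 2 * r j)) ^ s`, and `G j` is the product of the first `j`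
of these factors. -/
lemma mass_le_of_free_scales {A f R r G : ℕ → ℝ} {a s : ℝ} (ha : 0 < a) (ha1 : a ≤ 1)
    (hs : 0 < s) (hA0 : A 0 = 1) (hApos : ∀ n, 0 < A n) (hA : Antitone A)
    (hAa : ∀ n, a * A n ≤ A (n + 1)) (hf0 : f 0 ≤ 1) (hf : Antitone f)
    (hr : ∀ j, 0 < r j) (hrR : ∀ j, r j ≤ R j) (hRr : ∀ j, R (j + 1) ≤ r j) (hR : R 0 < 1)
    (hfree : ∀ n, (∀ j, ¬ (r j < A n ∧ A n ≤ R j)) → f (n + 1) * A n ^ s = f n * A (n + 1) ^ s)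
    (hG0 : G 0 = 1) (hG : ∀ j, G (j + 1) = (R j / (a ^ 2 * r j)) ^ s * G j) :
    ∀ j n, R j < A n → f n ≤ G j * A n ^ s := by
  have hRanti : Antitone R := antitone_nat_of_succ_le fun j => (hRr j).trans (hrR j)
  have hranti : Antitone r := antitone_nat_of_succ_le fun j => (hrR (j + 1)).trans (hRr j)
  have hRpos : ∀ j, 0 < R j := fun j => (hr j).trans_le (hrR j)
  have hstep : ∀ n g, (∀ j, ¬ (r j < A n ∧ A n ≤ R j)) → f n ≤ g * A n ^ s →
      f (n + 1) ≤ g * A (n + 1) ^ s := by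
    intro n g hn h
    have hpn : 0 < A n ^ s := Real.rpow_pos_of_pos (hApos n) s
    have hpn1 : 0 < A (n + 1) ^ s := Real.rpow_pos_of_pos (hApos _) s
    refine le_of_mul_le_mul_right ?_ hpn
    rw [hfree n hn]
    calc f n * A (n + 1) ^ s ≤ g * A n ^ s * A (n + 1) ^ s := by gcongr
      _ = g * A (n + 1) ^ s * A n ^ s := by ring
  have hGpos : ∀ j, 0 < G j := by
    intro j
    induction j with
    | zero => rw [hG0]; exact one_pos
    | succ j ih =>
      rw [hG]
      exact mul_pos (Real.rpow_pos_of_pos (div_pos (hRpos j)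
        (mul_pos (pow_pos ha 2) (hr j))) s) ih
  have hGmono : ∀ j, G j ≤ G (j + 1) := by
    intro j
    rw [hG]
    refine le_mul_of_one_le_left (hGpos j).le (Real.one_le_rpow ?_ hs.le)
    rw [one_le_div (mul_pos (pow_pos ha 2) (hr j))]
    calc a ^ 2 * r j ≤ 1 * r j := by
          have := hr j
          gcongr
          exact pow_le_one₀ ha.le ha1
      _ ≤ R j := by simpa using hrR j
  intro j
  induction j with
  | zero =>
    intro n
    induction n with
    | zero => intro _; simpa [hG0, hA0] using hf0
    | succ n ih =>
      intro hn
      have hlt : R 0 < A n := hn.trans_le (hA n.le_succ)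
      exact hstep n _ (fun i hi => absurd (hRanti (Nat.zero_le i)) (by linarith [hi.2])) (ih hlt)
  | succ j ihj =>
    intro n
    induction n with
    | zero =>
      intro _
      refine (ihj 0 ?_).trans ?_
      · rw [hA0]; exact (hRanti (Nat.zero_le j)).trans_lt hR
      · rw [hA0, Real.one_rpow, mul_one, mul_one]; exact hGmono j
    | succ n ih =>
      intro hn
      rcases lt_or_ge (R j) (A (n + 1)) with h1 | h1
      · refine (ihj _ h1).trans ?_
        have := Real.rpow_pos_of_pos (hApos (n + 1)) s
        gcongr
        exact hGmono j
      rcases lt_or_ge (a * r j) (A (n + 1)) with h2 | h2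
      · -- the interval `(r j, R j]` is entered at the first index `m + 1` with `A (m + 1) ≤ R j`
        obtain ⟨m, hmn, hm1, hm⟩ : ∃ m ≤ n, A (m + 1) ≤ R j ∧ R j < A m := by
          classical
          have hex : ∃ m, A m ≤ R j := ⟨_, h1⟩
          obtain ⟨m, hm⟩ : ∃ m, Nat.find hex = m + 1 := by
            refine Nat.exists_eq_succ_of_ne_zero fun h' => ?_
            have := Nat.find_spec hex
            rw [h', hA0] at this
            linarith [hRanti (Nat.zero_le j)]
          have h3 := Nat.find_spec hex
          have h4 := Nat.find_min' hex h1
          rw [hm] at h3 h4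
          exact ⟨m, by omega, h3, not_le.1 (Nat.find_min hex (m := m) (by omega))⟩
        have hAm : A m ≤ R j / a := by
          rw [le_div_iff₀ ha]
          linarith [hAa m]
        calc f (n + 1) ≤ f m := hf (by omega)
          _ ≤ G j * A m ^ s := ihj m hm
          _ ≤ G j * (R j / a) ^ s := by
            have := hGpos j
            have := hApos m
            gcongr
          _ = G (j + 1) * (a * r j) ^ s := by
            rw [hG, mul_right_comm, ← Real.mul_rpow, mul_comm]
            · congr 2
              have := (hr j).ne'
              field_simp
            · exact (div_pos (hRpos j) (mul_pos (pow_pos ha 2) (hr j))).le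
            · exact (mul_pos ha (hr j)).le
          _ ≤ G (j + 1) * A (n + 1) ^ s := by
            have := hGpos (j + 1)
            have := mul_pos ha (hr j)
            gcongr
      · -- the index `n` is already past the interval `(r j, R j]` and before the next one
        have hAn : A n ≤ r j := by
          refine le_of_mul_le_mul_left ((hAa n).trans h2) ha
        have hAn' : R (j + 1) < A n := hn.trans_le (hA n.le_succ)
        refine hstep n _ (fun i hi => ?_) (ih hAn')
        rcases le_or_gt i j with h | h
        · linarith [hranti h, hi.1]
        · linarith [hRanti (show j + 1 ≤ i from h), hi.2]

end MassBound

/-! ### The measure carried by small balls around the centres -/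

section Construction

variable {d k : ℕ} {S : Fin k → Euc d → Euc d} {α : Fin k → ℝ} {K : Set (Euc d)}

lemma setOf_initWord_eq (τ : ℕ → Fin k) (n : ℕ) :
    {ω : ℕ → Fin k | initWord ω (initWord τ n).length = initWord τ n} = PiNat.cylinder τ n := by
  ext ω
  rw [Set.mem_ofPred_eq, length_initWord, initWord_eq_iff, PiNat.mem_cylinder_iff]

/-- A sequence almost surely has no initial segment of mass zero. -/
lemma ae_forall_cylinder_ne_zero (P : Measure (ℕ → Fin k)) :
    ∀ᵐ ω ∂P, ∀ n, P (PiNat.cylinder ω n) ≠ 0 := by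
  rw [ae_iff]
  refine measure_mono_null (t := ⋃ w ∈ {w : List (Fin k) |
    P {ω | initWord ω w.length = w} = 0}, {ω | initWord ω w.length = w}) ?_ ?_
  · intro ω hω
    simp only [Set.mem_ofPred_eq, not_forall, not_not] at hω
    obtain ⟨n, hn⟩ := hω
    simp only [Set.mem_iUnion]
    refine ⟨initWord ω n, ?_, ?_⟩
    · rw [Set.mem_ofPred_eq, setOf_initWord_eq]; exact hn
    · rw [setOf_initWord_eq]; exact PiNat.self_mem_cylinder ω n
  · exact (measure_biUnion_null_iff (Set.to_countable _)).2 fun w hw => hw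

lemma sum_ofReal_rpow_eq_one {s : ℝ} (h0 : ∀ i, 0 < α i) (hs : ∑ i, α i ^ s = 1) :
    ∑ i, ENNReal.ofReal (α i ^ s) = 1 := by
  rw [← ENNReal.ofReal_sum_of_nonneg fun i _ => (Real.rpow_pos_of_pos (h0 i) s).le, hs,
    ENNReal.ofReal_one]

/-- If every cylinder of a word in `I(ρ)` has mass at most `b`, then the image under the coding map
gives mass at most `M * b` to any subset of a ball of radius `2ρ` that meets at most `M` of the
sets `K_v`, `v ∈ I(ρ)`. -/
lemma map_coding_le (hk : 0 < k) (hS : IsSimilitudeSystem S α) (hK : IsSelfSimilarSet S K)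
    {P : Measure (ℕ → Fin k)} {ρ : ℝ} (hρ : 0 < ρ) (hρ1 : ρ < 1) {M : ℕ} {x : Euc d}
    (hM : ∀ F : Finset (List (Fin k)),
      (∀ v ∈ F, v ∈ cutWords α ρ ∧ (wordMap S v '' K ∩ Metric.ball x (2 * ρ)).Nonempty) →
        F.card ≤ M) {b : ℝ≥0∞}
    (hb : ∀ ω n, initWord ω (n + 1) ∈ cutWords α ρ → P (PiNat.cylinder ω (n + 1)) ≤ b)
    {B : Set (Euc d)} (hB : B ⊆ Metric.ball x (2 * ρ)) :
    P.map (coding S K) B ≤ M * b := by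
  refine (measure_mono hB).trans ?_
  rw [Measure.map_apply (continuous_coding hS hK).measurable measurableSet_ball]
  let F : Set (List (Fin k)) :=
    {v | v ∈ cutWords α ρ ∧ (wordMap S v '' K ∩ Metric.ball x (2 * ρ)).Nonempty}
  have hF : F.Finite := by
    by_contra hinf
    obtain ⟨T, hTF, hT⟩ := Set.Infinite.exists_subset_card_eq hinf (M + 1)
    have := hM T fun v hv => hTF hv
    omega
  have hcard : hF.toFinset.card ≤ M := hM _ fun v hv => by simpa [F] using hv
  have hsub : coding S K ⁻¹' Metric.ball x (2 * ρ) ⊆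
      ⋃ v ∈ hF.toFinset, {ω | initWord ω v.length = v} := by
    intro ω hω
    obtain ⟨n, hn⟩ := exists_initWord_mem_cutWords hS.ratio_pos hS.ratio_lt_one hρ hρ1 ω
    simp only [Set.mem_iUnion]
    refine ⟨initWord ω (n + 1), ?_, ?_⟩
    · rw [Set.Finite.mem_toFinset]
      exact ⟨hn, _, coding_mem hS hK ω _, hω⟩
    · simp
  refine (measure_mono hsub).trans ((measure_biUnion_finset_le _ _).trans ?_)
  refine (Finset.sum_le_card_nsmul _ _ b fun v hv => ?_).trans ?_
  · have hv' : v ∈ F := by simpa using hv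
    obtain ⟨ω, n, rfl⟩ := exists_eq_initWord_of_mem_cutWords hk hv'.1
    rw [setOf_initWord_eq]
    exact hb ω n hv'.1
  · rw [nsmul_eq_mul]
    gcongr

/-- The random sequence that follows the code of the centre `c j v`, `v ∈ I(R j)`, at the scales in
`(r j, R j]`, and has independent letters at all the other scales. -/
lemma exists_forced_measure (hk : 0 < k) (hS : IsSimilitudeSystem S α) (hK : IsSelfSimilarSet S K)
    {a s : ℝ} (ha : 0 < a) (ha1 : a ≤ 1) (haα : ∀ i, a ≤ α i) (hs0 : 0 < s)
    (hs : ∑ i, α i ^ s = 1) {R r G : ℕ → ℝ} (hr : ∀ j, 0 < r j) (hrR : ∀ j, r j ≤ R j)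
    (hRr : ∀ j, R (j + 1) ≤ r j) (hR : R 0 < 1) (hG0 : G 0 = 1)
    (hG : ∀ j, G (j + 1) = (R j / (a ^ 2 * r j)) ^ s * G j)
    (c : ℕ → List (Fin k) → Euc d) (hc : ∀ j, ∀ v ∈ cutWords α (R j), c j v ∈ wordMap S v '' K) :
    ∃ P : Measure (ℕ → Fin k), IsProbabilityMeasure P ∧
      (∀ j ω n, R j < wordRatio α (initWord ω n) →
        P.real (PiNat.cylinder ω n) ≤ G j * wordRatio α (initWord ω n) ^ s) ∧
      ∀ᵐ ω ∂P, ∀ j, ∃ v ∈ cutWords α (R j), dist (coding S K ω) (c j v) ≤ r j * Metric.diam K := by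
  classical
  have h0 := hS.ratio_pos
  have h1 := hS.ratio_lt_one
  have hRanti : Antitone R := antitone_nat_of_succ_le fun j => (hRr j).trans (hrR j)
  have hRpos : ∀ j, 0 < R j := fun j => (hr j).trans_le (hrR j)
  have hR1 : ∀ j, R j < 1 := fun j => (hRanti (Nat.zero_le j)).trans_lt hR
  have hcode : ∀ j v, ∃ τ : ℕ → Fin k, v ∈ cutWords α (R j) →
      initWord τ v.length = v ∧ ∀ n, c j v ∈ wordMap S (initWord τ n) '' K := by
    intro j v
    by_cases hv : v ∈ cutWords α (R j)
    · obtain ⟨τ, hτ⟩ := exists_code_of_mem hK v (hc j v hv)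
      exact ⟨τ, fun _ => hτ⟩
    · exact ⟨fun _ => ⟨0, hk⟩, fun h => absurd h hv⟩
  choose code hcode using hcode
  have hlt : ∀ {i j : ℕ} {y : ℝ}, y ≤ R j → r i < y → j ≤ i := by
    intro i j y hy hiy
    by_contra h
    linarith [hRanti (show i + 1 ≤ j by omega), hRr i]
  -- the intervals `(r j, R j]` are disjoint and a word has one prefix in `I(R j)`, so that at most
  -- one code prescribes the letter after `w`
  have hletter : ∀ w : List (Fin k), ∃ i : Fin k, ∀ j, r j < wordRatio α w → wordRatio α w ≤ R j →
      ∀ v ∈ cutWords α (R j), v <+: w → i = code j v w.length := by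
    intro w
    by_cases h : ∃ j, r j < wordRatio α w ∧ wordRatio α w ≤ R j ∧ ∃ v ∈ cutWords α (R j), v <+: w
    · obtain ⟨j, hj1, hj2, v, hv, hvw⟩ := h
      refine ⟨code j v w.length, fun i hi1 hi2 u hu huw => ?_⟩
      obtain rfl : i = j := le_antisymm (hlt hi2 hj1) (hlt hj2 hi1)
      have : v = u := by
        rcases List.prefix_or_prefix_of_prefix hvw huw with h | h
        · exact eq_of_prefix_of_mem_cutWords h0 h1 hv hu h
        · exact (eq_of_prefix_of_mem_cutWords h0 h1 hu hv h).symm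
      rw [this]
    · refine ⟨⟨0, hk⟩, fun j hj1 hj2 v hv hvw => absurd ⟨j, hj1, hj2, v, hv, hvw⟩ h⟩
  choose letter hletter using hletter
  let t : List (Fin k) → Fin k → ℝ≥0∞ := fun w i =>
    if ∃ j, r j < wordRatio α w ∧ wordRatio α w ≤ R j then (if i = letter w then 1 else 0)
    else ENNReal.ofReal (α i ^ s)
  have ht : ∀ w, ∑ i, t w i = 1 := by
    intro w
    by_cases h : ∃ j, r j < wordRatio α w ∧ wordRatio α w ≤ R j
    · simp [t, h]
    · simp only [t, h, if_false]
      exact sum_ofReal_rpow_eq_one h0 hs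
  obtain ⟨P, hP, hPt⟩ := exists_treeMeasure t ht
  refine ⟨P, hP, fun j ω n hn => ?_, ?_⟩
  · refine mass_le_of_free_scales (A := fun n => wordRatio α (initWord ω n))
      (f := fun n => P.real (PiNat.cylinder ω n)) ha ha1 hs0 (by simp)
      (fun n => wordRatio_pos h0 _) (antitone_wordRatio_initWord h0 h1 ω) (fun n => ?_)
      measureReal_le_one (fun m n hmn => measureReal_mono (PiNat.cylinder_anti ω hmn))
      hr hrR hRr hR (fun n hn => ?_) hG0 hG j n hn
    · rw [wordRatio_initWord_succ, mul_comm]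
      exact mul_le_mul_of_nonneg_left (haα _) (wordRatio_pos h0 _).le
    · have hfree : ¬ ∃ j, r j < wordRatio α (initWord ω n) ∧ wordRatio α (initWord ω n) ≤ R j := by
        push Not
        exact fun j hj => not_le.1 fun h => hn j ⟨hj, h⟩
      simp only [Measure.real]
      rw [hPt, wordRatio_initWord_succ, Real.mul_rpow (wordRatio_pos h0 _).le (h0 _).le]
      simp only [t, hfree, if_false, ENNReal.toReal_mul]
      rw [ENNReal.toReal_ofReal (Real.rpow_pos_of_pos (h0 _) s).le]
      ring
  · filter_upwards [ae_forall_cylinder_ne_zero P] with ω hω j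
    obtain ⟨m, hm⟩ := exists_initWord_mem_cutWords h0 h1 (hRpos j) (hR1 j) ω
    obtain ⟨l, hl⟩ := exists_initWord_mem_cutWords h0 h1 (hr j) ((hrR j).trans_lt (hR1 j)) ω
    refine ⟨_, hm, ?_⟩
    obtain ⟨hτ1, hτ2⟩ := hcode j _ hm
    set τ := code j (initWord ω (m + 1)) with hτ
    rw [length_initWord, initWord_eq_iff] at hτ1
    have hA := antitone_wordRatio_initWord h0 h1 ω
    rw [initWord_mem_cutWords_iff] at hl
    -- a letter against the code has probability zero, so `ω` follows the code down to scale `r j`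
    have hagree : initWord ω (l + 1) = initWord τ (l + 1) := by
      refine initWord_congr fun i hi => ?_
      rcases lt_or_ge i (m + 1) with him | him
      · exact (hτ1 i him).symm
      have hi1 : r j < wordRatio α (initWord ω i) := hl.2.trans_le (hA (show i ≤ l by omega))
      have hi2 : wordRatio α (initWord ω i) ≤ R j :=
        (hA him).trans (initWord_mem_cutWords_iff.1 hm).1
      have hne : t (initWord ω i) (ω i) ≠ 0 := fun h => hω (i + 1) (by rw [hPt, h, mul_zero])
      have hforced : ∃ j, r j < wordRatio α (initWord ω i) ∧ wordRatio α (initWord ω i) ≤ R j :=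
        ⟨j, hi1, hi2⟩
      have hpre : initWord ω (m + 1) <+: initWord ω i := by
        rw [← take_initWord ω him]
        exact List.take_prefix _ _
      have := hletter (initWord ω i) j hi1 hi2 _ hm hpre
      rw [length_initWord] at this
      rw [hτ, ← this]
      by_contra hne'
      exact hne (by simp only [t, hforced, if_true, hne', if_false])
    refine (hS.dist_le_of_mem_image hK.isCompact _ (coding_mem hS hK ω (l + 1)) ?_).trans
      (mul_le_mul_of_nonneg_right hl.1 Metric.diam_nonneg)
    rw [hagree]
    exact hτ2 _

end Construction

/-! ### Cantor sets carrying an atomless measure, and the mass distribution principle -/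

section Cantor

variable {d : ℕ}

/-- An atomless finite measure charges a Cantor subset of every measurable set that it charges.
Removing a countable family of null hyperplanes that separates points makes the set totally
disconnected; the support of the restriction to a compact subset has no isolated points. -/
lemma exists_isCantorSet_subset (m : Measure (Euc d)) [IsFiniteMeasure m] (hm : ∀ x, m {x} = 0)
    {E : Set (Euc d)} (hE : MeasurableSet E) (hE0 : 0 < m E) :
    ∃ A ⊆ E, IsCantorSet A ∧ 0 < m A := by
  have hcoord : ∀ i : Fin d, Measurable fun x : Euc d => x i := fun i =>
    (EuclideanSpace.proj (𝕜 := ℝ) i).continuous.measurable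
  have hT : ∀ (i : Fin d) (p q : ℚ), ∃ t : ℝ, (p : ℝ) < q →
      p < t ∧ t < q ∧ m {x | x i = t} = 0 := by
    intro i p q
    by_cases hpq : (p : ℝ) < q
    · have hc := Measure.countable_meas_level_set_pos (μ := m) (hcoord i)
      obtain ⟨t, ht, htc⟩ := (hc.dense_compl ℝ).exists_between hpq
      exact ⟨t, fun _ => ⟨htc.1, htc.2, by simpa using ht⟩⟩
    · exact ⟨0, fun h => absurd h hpq⟩
  choose t ht using hT
  let Z : Set (Euc d) := ⋃ (i : Fin d) (p : ℚ) (q : ℚ) (_ : (p : ℝ) < q), {x | x i = t i p q}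
  have hZ0 : m Z = 0 := by
    refine measure_iUnion_null fun i => measure_iUnion_null fun p => measure_iUnion_null fun q =>
      measure_iUnion_null fun h => (ht i p q h).2.2
  have hZm : MeasurableSet Z := by
    refine MeasurableSet.iUnion fun i => MeasurableSet.iUnion fun p => MeasurableSet.iUnion fun q =>
      MeasurableSet.iUnion fun _ => hcoord i (measurableSet_singleton _)
  have hpos : 0 < m (E \ Z) := by rwa [measure_sdiff_null hZ0]
  obtain ⟨L, hLE, hLc, hL⟩ :=
    (hE.diff hZm).exists_lt_isCompact_of_ne_top (measure_ne_top _ _) hpos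
  set n := m.restrict L with hn
  have hnL : n.support ⊆ L := by
    refine Measure.support_subset_of_isClosed hLc.isClosed ?_
    rw [mem_ae_iff, hn, Measure.restrict_apply hLc.isClosed.measurableSet.compl]
    simp
  have hmn : m n.support = m L := by
    have h1 : n n.supportᶜ = 0 := Measure.measure_compl_support
    have h2 := measure_add_measure_compl (μ := n) (s := n.support)
      Measure.isClosed_support.measurableSet
    rw [h1, add_zero, hn, Measure.restrict_apply Measure.isClosed_support.measurableSet,
      Measure.restrict_apply MeasurableSet.univ, Set.univ_inter, ← hn,
      Set.inter_eq_left.2 hnL] at h2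
    exact h2
  refine ⟨n.support, hnL.trans (hLE.trans Set.sdiff_subset), ⟨?_, ?_, ?_, ?_⟩, by rwa [hmn]⟩
  · by_contra h
    rw [Set.not_nonempty_iff_eq_empty.1 h, measure_empty] at hmn
    exact hL.ne hmn
  · exact hLc.of_isClosed_subset Measure.isClosed_support hnL
  · intro x hx
    rw [accPt_iff_nhds]
    intro U hU
    have h1 : 0 < n U := (Measure.mem_support_iff_forall x).1 hx U hU
    have h2 : n ({x} ∪ n.supportᶜ) = 0 := by
      refine measure_union_null ?_ Measure.measure_compl_support
      exact le_antisymm ((Measure.restrict_apply_le _ _).trans (hm x).le) (zero_le)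
    by_contra! h
    refine h1.ne' (measure_mono_null (fun y hy => ?_) h2)
    by_cases hys : y ∈ n.support
    · exact Or.inl (h y ⟨hy, hys⟩)
    · exact Or.inr hys
  · intro C hC hCp x hx y hy
    by_contra hxy
    have : ∃ i, x i ≠ y i := by
      by_contra! h
      exact hxy (PiLp.ext h)
    obtain ⟨i, hi⟩ := this
    have key : ∀ x ∈ C, ∀ y ∈ C, ¬ x i < y i := by
      intro x hx y hy hlt
      obtain ⟨p, hp1, hp2⟩ := exists_rat_btwn hlt
      obtain ⟨q, hq1, hq2⟩ := exists_rat_btwn hp2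
      obtain ⟨h1, h2, -⟩ := ht i p q hq1
      obtain ⟨z, hz, hzt⟩ := hCp.intermediate_value hx hy
        (EuclideanSpace.proj (𝕜 := ℝ) i).continuous.continuousOn
        (show t i p q ∈ Set.Icc _ _ from ⟨(hp1.trans h1).le, (h2.trans hq2).le⟩)
      refine (hLE (hnL (hC hz))).2 ?_
      simp only [Z, Set.mem_iUnion]
      exact ⟨i, p, q, hq1, hzt⟩
    rcases lt_or_gt_of_ne hi with h | h
    · exact key x hx y hy h
    · exact key y hy x hx h

/-- The mass distribution principle. -/
lemma le_dimH_of_measure_le {X : Type*} [MetricSpace X] [MeasurableSpace X] [BorelSpace X]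
    {m : Measure X} {C t : ℝ} {η : ℝ≥0∞} (hC : 0 < C) (ht : 0 ≤ t) (hη : 0 < η)
    (h : ∀ B, MeasurableSet B → Metric.ediam B ≤ η → m B ≤ ENNReal.ofReal C * Metric.ediam B ^ t)
    {E : Set X} (hE : 0 < m E) : ENNReal.ofReal t ≤ dimH E := by
  have hC0 : ENNReal.ofReal C ≠ 0 := by simpa using hC
  by_contra! hlt
  have h0 : μH[t] E = 0 := by
    have := hausdorffMeasure_of_dimH_lt (s := E) (d := t.toNNReal) hlt
    rwa [Real.coe_toNNReal _ ht] at this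
  have hle : (ENNReal.ofReal C)⁻¹ • m ≤ μH[t] := by
    refine Measure.le_hausdorffMeasure t _ η hη fun B hB => ?_
    have h1 := h (closure B) isClosed_closure.measurableSet (by rwa [Metric.ediam_closure])
    rw [Metric.ediam_closure] at h1
    rw [Measure.smul_apply, smul_eq_mul]
    calc (ENNReal.ofReal C)⁻¹ * m B
        ≤ (ENNReal.ofReal C)⁻¹ * (ENNReal.ofReal C * Metric.ediam B ^ t) := by
          gcongr
          exact (measure_mono subset_closure).trans h1
      _ = Metric.ediam B ^ t := by
          rw [← mul_assoc, ENNReal.inv_mul_cancel hC0 ENNReal.ofReal_ne_top, one_mul]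
  have h2 := hle E
  rw [h0, Measure.smul_apply, smul_eq_mul, le_zero_iff, mul_eq_zero] at h2
  rcases h2 with h2 | h2
  · exact ENNReal.ofReal_ne_top (ENNReal.inv_eq_zero.1 h2)
  · exact hE.ne' h2

end Cantor

/-! ### Sparse scales and the estimate of the mass of balls -/

section KeyEstimate

/-- A subsequence along which the scales decrease so fast that the cost `G j` of crossing the first
`j` of the intervals `(r, R]` is negligible at the next scale. -/
lemma exists_sparse_scales {R r : ℕ → ℝ} (hr : ∀ p, 0 < r p)
    (hlim : Tendsto R atTop (𝓝 0)) (a s : ℝ) :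
    ∃ (φ : ℕ → ℕ) (G : ℕ → ℝ), StrictMono φ ∧ 1 ≤ φ 0 ∧ (∀ j, R (φ j) < 1) ∧ G 0 = 1 ∧
      (∀ j, G (j + 1) = (R (φ j) / (a ^ 2 * r (φ j))) ^ s * G j) ∧
      (∀ j, R (φ (j + 1)) ≤ r (φ j)) ∧
      ∀ j : ℕ, G j * R (φ j) ^ (1 / ((j : ℝ) + 1)) ≤ 1 := by
  let c : ℕ → ℝ := fun p => (R p / (a ^ 2 * r p)) ^ s
  have hsmall : ∀ (e g : ℝ), 0 < e → ∀ᶠ q in atTop, g * R q ^ e ≤ 1 := by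
    intro e g he
    have h1 : Tendsto (fun q => g * R q ^ e) atTop (𝓝 (g * 0 ^ e)) :=
      ((hlim.rpow_const (Or.inr he.le))).const_mul g
    rw [Real.zero_rpow he.ne', mul_zero] at h1
    exact h1.eventually (ge_mem_nhds one_pos)
  have hstep : ∀ (j p : ℕ) (g : ℝ), ∃ q, p < q ∧ R q < 1 ∧ R q ≤ r p ∧
      c p * g * R q ^ (1 / (((j + 1 : ℕ) : ℝ) + 1)) ≤ 1 := by
    intro j p g
    exact ((eventually_gt_atTop p).and ((hlim.eventually (gt_mem_nhds one_pos)).and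
      ((hlim.eventually (ge_mem_nhds (hr p))).and (hsmall _ _ (by positivity))))).exists
  choose nxt hnxt using hstep
  obtain ⟨p₀, hp₀, hp₀R⟩ := ((eventually_ge_atTop 1).and
    (hlim.eventually (gt_mem_nhds one_pos))).exists
  let st : ℕ → ℕ × ℝ := fun j =>
    Nat.rec (p₀, 1) (fun j q => (nxt j q.1 q.2, c q.1 * q.2)) j
  refine ⟨fun j => (st j).1, fun j => (st j).2, strictMono_nat_of_lt_succ fun j =>
    (hnxt j _ _).1, hp₀, fun j => ?_, rfl, fun _ => rfl, fun j => (hnxt j _ _).2.2.1, fun j => ?_⟩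
  · cases j with
    | zero => exact hp₀R
    | succ j => exact (hnxt j _ _).2.1
  · cases j with
    | zero => simpa [st] using hp₀R.le
    | succ j => exact (hnxt j _ _).2.2.2

variable {d k : ℕ} {S : Fin k → Euc d → Euc d} {α : Fin k → ℝ} {K : Set (Euc d)}

lemma measurableSet_inter_iInter_iUnion_closedBall (hK : IsCompact K)
    (I : ℕ → Set (List (Fin k))) (c : ℕ → List (Fin k) → Euc d) (ρ : ℕ → ℝ) :
    MeasurableSet (K ∩ ⋂ j, ⋃ v ∈ I j, Metric.closedBall (c j v) (ρ j)) :=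
  hK.isClosed.measurableSet.inter <| MeasurableSet.iInter fun _ =>
    MeasurableSet.biUnion (Set.to_countable _) fun _ _ => Metric.isClosed_closedBall.measurableSet

/-- Given centres `c p v ∈ K_v`, `v ∈ I(R p)`, there is a probability measure such that almost
every point is at distance at most `R p ^ θ` from one of the centres for infinitely many `p`, and
such that the mass of a set of diameter `ρ` is at most `ρ ^ (s / θ - o(1))`. -/
lemma exists_measure_on_centres (hk : 0 < k) (hS : IsSimilitudeSystem S α)
    (hU : OpenSetCondition S) (hK : IsSelfSimilarSet S K) {s : ℝ} (hs0 : 0 < s)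
    (hs : ∑ i, α i ^ s = 1) {R : ℕ → ℝ} (hR : ∀ p, 0 < R p) (hlim : Tendsto R atTop (𝓝 0))
    (c : ℕ → List (Fin k) → Euc d)
    (hc : ∀ p ≥ 1, ∀ v ∈ cutWords α (R p), c p v ∈ wordMap S v '' K) {θ : ℝ} (hθ : 1 ≤ θ) :
    ∃ (m : Measure (Euc d)) (φ : ℕ → ℕ) (C : ℝ), IsProbabilityMeasure m ∧ StrictMono φ ∧
      1 ≤ φ 0 ∧ (∀ j, R (φ j) < 1) ∧ 0 < C ∧
      (∀ᵐ z ∂m, z ∈ K ∩ ⋂ j, ⋃ v ∈ cutWords α (R (φ j)),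
        Metric.closedBall (c (φ j) v) (R (φ j) ^ θ)) ∧
      ∀ (j : ℕ) (ρ : ℝ) (x : Euc d) (B : Set (Euc d)), R (φ (j + 1)) ≤ ρ → ρ ≤ R (φ j) →
        B ⊆ Metric.ball x (2 * ρ) →
          m B ≤ ENNReal.ofReal (C * ρ ^ (s / θ - 1 / ((j : ℝ) + 1))) := by
  have h0 := hS.ratio_pos
  obtain ⟨a, -, ha, ha1, -, -, haα, -⟩ := exists_ratio_bounds h0 hS.ratio_lt_one
  obtain ⟨M, hM⟩ := exists_card_cutWords_le hk hS hU hK.isCompact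
  have hθ0 : 0 < θ := one_pos.trans_le hθ
  -- a set `K_u` with ratio at most `R ^ θ / D` has diameter at most `R ^ θ`
  set D := Metric.diam K + 1 with hD
  have hD1 : 1 ≤ D := by
    have := Metric.diam_nonneg (s := K)
    linarith
  have hD0 : 0 < D := one_pos.trans_le hD1
  let r : ℕ → ℝ := fun p => R p ^ θ / D
  have hr : ∀ p, 0 < r p := fun p => div_pos (Real.rpow_pos_of_pos (hR p) θ) hD0
  obtain ⟨φ, G, hφ, hφ0, hφ1, hG0, hG, hRr, hGR⟩ := exists_sparse_scales hr hlim a s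
  have hrR : ∀ j, r (φ j) ≤ R (φ j) := by
    intro j
    refine (div_le_self (Real.rpow_pos_of_pos (hR _) θ).le hD1).trans ?_
    simpa using Real.rpow_le_rpow_of_exponent_ge (hR _) (hφ1 j).le hθ
  obtain ⟨P, hP, hPm, hPc⟩ := exists_forced_measure hk hS hK (R := fun j => R (φ j))
    (r := fun j => r (φ j)) ha ha1.le haα hs0 hs (fun j => hr _) hrR hRr (hφ1 0) hG0 hG
    (fun j => c (φ j)) (fun j v hv => hc _ (hφ0.trans (hφ.monotone (Nat.zero_le j))) v hv)
  have hGpos : ∀ j, 0 < G j := by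
    intro j
    induction j with
    | zero => rw [hG0]; exact one_pos
    | succ j ih =>
      rw [hG]
      exact mul_pos (Real.rpow_pos_of_pos (div_pos (hR _) (mul_pos (pow_pos ha 2) (hr _))) s) ih
  have hcm := (continuous_coding hS hK).measurable
  have hball : ∀ (j : ℕ) (ρ : ℝ) (x : Euc d) (B : Set (Euc d)), 0 < ρ → ρ < 1 → R (φ j) ≤ ρ →
      B ⊆ Metric.ball x (2 * ρ) →
      P.map (coding S K) B ≤ ENNReal.ofReal (M * (G j * (ρ / a) ^ s)) := by
    intro j ρ x B hρ hρ1 hRρ hB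
    rw [ENNReal.ofReal_mul (by positivity), ENNReal.ofReal_natCast]
    refine map_coding_le hk hS hK hρ hρ1 (hM ρ hρ x) (fun ω n hn => ?_) hB
    rw [initWord_mem_cutWords_iff] at hn
    have hle : wordRatio α (initWord ω n) ≤ ρ / a := by
      rw [le_div_iff₀ ha]
      refine le_trans ?_ hn.1
      rw [wordRatio_initWord_succ]
      exact mul_le_mul_of_nonneg_left (haα _) (wordRatio_pos h0 _).le
    have h1 : P.real (PiNat.cylinder ω (n + 1)) ≤ G j * (ρ / a) ^ s := by
      refine (measureReal_mono (PiNat.cylinder_anti ω n.le_succ)).trans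
        ((hPm j ω n (hRρ.trans_lt hn.2)).trans ?_)
      have := hGpos j
      have := wordRatio_pos h0 (initWord ω n)
      gcongr
    rw [← ofReal_measureReal]
    exact ENNReal.ofReal_le_ofReal h1
  refine ⟨P.map (coding S K), φ, M * (a ^ 3)⁻¹ ^ s * D ^ s + 1,
    Measure.isProbabilityMeasure_map hcm.aemeasurable, hφ, hφ0, hφ1, by positivity, ?_, ?_⟩
  · set E := K ∩ ⋂ j, ⋃ v ∈ cutWords α (R (φ j)), Metric.closedBall (c (φ j) v) (R (φ j) ^ θ)
    have hE : MeasurableSet E := measurableSet_inter_iInter_iUnion_closedBall hK.isCompact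
      (fun j => cutWords α (R (φ j))) (fun j => c (φ j)) _
    refine (ae_map_iff (p := fun z => z ∈ E) hcm.aemeasurable hE).2 ?_
    filter_upwards [hPc] with ω hω
    refine ⟨coding_mem_set hS hK ω, Set.mem_iInter.2 fun j => ?_⟩
    obtain ⟨v, hv, hdist⟩ := hω j
    simp only [Set.mem_iUnion]
    refine ⟨v, hv, hdist.trans ?_⟩
    calc r (φ j) * Metric.diam K ≤ r (φ j) * D := by
          have := hr (φ j)
          gcongr
          linarith
      _ = R (φ j) ^ θ := div_mul_cancel₀ _ hD0.ne'
  · intro j ρ x B hRρ hρR hB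
    have hρ : 0 < ρ := (hR _).trans_le hRρ
    have hρ1 : ρ < 1 := hρR.trans_lt (hφ1 j)
    set e : ℝ := 1 / ((j : ℝ) + 1) with he
    have he0 : 0 < e := by positivity
    have hGe : G j ≤ ρ ^ (-e) := by
      rw [Real.rpow_neg hρ.le, ← one_div, le_div_iff₀ (Real.rpow_pos_of_pos hρ e)]
      refine le_trans ?_ (hGR j)
      have := hGpos j
      gcongr
    have hRθ : R (φ j) = (D * r (φ j)) ^ (1 / θ) := by
      simp only [r]
      rw [mul_div_cancel₀ _ hD0.ne', ← Real.rpow_mul (hR _).le, mul_one_div_cancel hθ0.ne',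
        Real.rpow_one]
    have hDρ : (D * ρ) ^ (1 / θ) ≤ D * ρ ^ (1 / θ) := by
      rw [Real.mul_rpow hD0.le hρ.le]
      gcongr
      have : 1 / θ ≤ 1 := by rw [div_le_one hθ0]; exact hθ
      simpa using Real.rpow_le_rpow_of_exponent_le hD1 this
    -- it is enough to bound the mass in terms of a length `T` that is at most `D * ρ ^ (1 / θ)`
    have hfin : ∀ T : ℝ, 0 ≤ T → T ≤ (D * ρ) ^ (1 / θ) →
        P.map (coding S K) B ≤ ENNReal.ofReal (M * (G j * (T / a ^ 3) ^ s)) →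
        P.map (coding S K) B ≤ ENNReal.ofReal ((M * (a ^ 3)⁻¹ ^ s * D ^ s + 1) *
          ρ ^ (s / θ - e)) := by
      intro T hT0 hT h
      refine h.trans (ENNReal.ofReal_le_ofReal ?_)
      have hpow : ρ ^ (s / θ - e) = ρ ^ (-e) * (ρ ^ (1 / θ)) ^ s := by
        rw [← Real.rpow_mul hρ.le, ← Real.rpow_add hρ]
        congr 1
        ring
      have h3 : (T / a ^ 3) ^ s ≤ (a ^ 3)⁻¹ ^ s * (D ^ s * (ρ ^ (1 / θ)) ^ s) := by
        rw [← Real.mul_rpow hD0.le (by positivity), ← Real.mul_rpow (by positivity) (by positivity),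
          div_eq_inv_mul]
        gcongr
        exact hT.trans hDρ
      calc (M : ℝ) * (G j * (T / a ^ 3) ^ s)
          ≤ M * (ρ ^ (-e) * ((a ^ 3)⁻¹ ^ s * (D ^ s * (ρ ^ (1 / θ)) ^ s))) := by
            have := hGpos j
            gcongr
        _ = (M * (a ^ 3)⁻¹ ^ s * D ^ s) * ρ ^ (s / θ - e) := by rw [hpow]; ring
        _ ≤ _ := by
            have := Real.rpow_pos_of_pos hρ (s / θ - e)
            gcongr
            linarith
    rcases le_total ρ (r (φ j)) with h | h
    · -- below `r (φ j)` the letters are free again: count cylinders of size `ρ`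
      refine hfin (R (φ j) * (ρ / r (φ j))) (mul_nonneg (hR _).le (div_nonneg hρ.le (hr _).le)) ?_
        ((hball (j + 1) ρ x B hρ hρ1 hRρ hB).trans_eq ?_)
      · have hx1 : ρ / r (φ j) ≤ 1 := (div_le_one (hr _)).2 h
        have hx0 : 0 < ρ / r (φ j) := div_pos hρ (hr _)
        calc R (φ j) * (ρ / r (φ j)) ≤ R (φ j) * (ρ / r (φ j)) ^ (1 / θ) := by
              have := hR (φ j)
              gcongr
              have h4 : 1 / θ ≤ 1 := by rw [div_le_one hθ0]; exact hθ
              simpa using Real.rpow_le_rpow_of_exponent_ge hx0 hx1 h4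
          _ = (D * ρ) ^ (1 / θ) := by
              conv_lhs => rw [hRθ]
              rw [← Real.mul_rpow (mul_pos hD0 (hr _)).le hx0.le]
              congr 1
              have := (hr (φ j)).ne'
              field_simp
      · rw [hG]
        congr 2
        rw [mul_right_comm, mul_comm _ (G j), ← Real.mul_rpow]
        · congr 2
          have := (hr (φ j)).ne'
          field_simp
        · exact (div_pos (hR _) (mul_pos (pow_pos ha 2) (hr _))).le
        · positivity
    · -- between `r (φ j)` and `R (φ j)` the letters are prescribed: count
      -- cylinders of size `R (φ j)`
      refine hfin (R (φ j)) (hR _).le ?_ ((hball j (R (φ j)) x B (hR _) (hφ1 j) le_rfl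
        (hB.trans (Metric.ball_subset_ball (by linarith)))).trans ?_)
      · rw [hRθ]
        exact Real.rpow_le_rpow (mul_pos hD0 (hr _)).le (by gcongr) (by positivity)
      · have := hGpos j
        have := hR (φ j)
        have h5 : a ^ 3 ≤ a := by
          simpa using pow_le_pow_of_le_one ha.le ha1.le (show 1 ≤ 3 by norm_num)
        gcongr

end KeyEstimate

/-! ### The Cantor measure and its dimension -/

section CantorMeasure

variable {d k : ℕ} {S : Fin k → Euc d → Euc d} {α : Fin k → ℝ} {K : Set (Euc d)}

/-- The normalized restriction of the measure of `exists_measure_on_centres` to a Cantor set. -/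
lemma exists_cantor_measure (hk : 0 < k) (hS : IsSimilitudeSystem S α)
    (hU : OpenSetCondition S) (hK : IsSelfSimilarSet S K) {s : ℝ} (hs0 : 0 < s)
    (hs : ∑ i, α i ^ s = 1) {R : ℕ → ℝ} (hR : ∀ p, 0 < R p) (hanti : StrictAnti R)
    (hlim : Tendsto R atTop (𝓝 0)) (c : ℕ → List (Fin k) → Euc d)
    (hc : ∀ p ≥ 1, ∀ v ∈ cutWords α (R p), c p v ∈ wordMap S v '' K) {θ : ℝ} (hθ : 1 ≤ θ) :
    ∃ (m : Measure (Euc d)) (A : Set (Euc d)) (φ : ℕ → ℕ), IsProbabilityMeasure m ∧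
      IsCantorSet A ∧ StrictMono φ ∧
      A ⊆ (K ∩ ⋂ j, ⋃ v ∈ cutWords α (R (φ j)), Metric.closedBall (c (φ j) v) (R (φ j) ^ θ)) ∧
      m Aᶜ = 0 ∧ ∃ (C : ℝ) (η : ℕ → ℝ), 0 < C ∧ (∀ p, 0 < η p) ∧ StrictAnti η ∧
        Tendsto η atTop (𝓝 0) ∧ ∀ p : ℕ, 2 ≤ p → ∀ B : Set (Euc d), MeasurableSet B →
          Metric.ediam B ≤ ENNReal.ofReal (η p) →
            m B ≤ ENNReal.ofReal C * Metric.ediam B ^ (s / θ - 2 / ((p : ℝ) - 1)) := by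
  obtain ⟨m, φ, C, hm, hφ, -, hφ1, hC, hae, hB⟩ :=
    exists_measure_on_centres hk hS hU hK hs0 hs hR hlim c hc hθ
  set E := K ∩ ⋂ j, ⋃ v ∈ cutWords α (R (φ j)), Metric.closedBall (c (φ j) v) (R (φ j) ^ θ)
  have hE : MeasurableSet E := measurableSet_inter_iInter_iUnion_closedBall hK.isCompact
    (fun j => cutWords α (R (φ j))) (fun j => c (φ j)) _
  have hE1 : m E = 1 := (prob_compl_eq_zero_iff hE).1 hae
  have hRφ : Tendsto (fun j => R (φ j)) atTop (𝓝 0) := hlim.comp hφ.tendsto_atTop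
  have hsθ : 0 < s / θ := by positivity
  have hatom : ∀ x, m {x} = 0 := by
    intro x
    have he : Tendsto (fun j : ℕ => 1 / ((j : ℝ) + 1)) atTop (𝓝 0) :=
      tendsto_one_div_add_atTop_nhds_zero_nat
    have hle : ∀ᶠ j : ℕ in atTop, m {x} ≤ ENNReal.ofReal (C * R (φ j) ^ (s / θ / 2)) := by
      filter_upwards [he.eventually (gt_mem_nhds (half_pos hsθ))] with j hj
      refine (hB j (R (φ j)) x {x} (hanti.antitone (hφ.monotone j.le_succ)) le_rfl
        (by simpa using hR (φ j))).trans (ENNReal.ofReal_le_ofReal ?_)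
      refine mul_le_mul_of_nonneg_left ?_ hC.le
      exact Real.rpow_le_rpow_of_exponent_ge (hR _) (hφ1 j).le (by linarith)
    have hlim0 : Tendsto (fun j => ENNReal.ofReal (C * R (φ j) ^ (s / θ / 2))) atTop (𝓝 0) := by
      have h1 := (hRφ.rpow_const (Or.inr (half_pos hsθ).le)).const_mul C
      rw [Real.zero_rpow (half_pos hsθ).ne', mul_zero] at h1
      simpa using ENNReal.tendsto_ofReal h1
    exact le_antisymm (ge_of_tendsto hlim0 hle) zero_le
  obtain ⟨A, hAE, hA, hmA⟩ := exists_isCantorSet_subset m hatom hE (by rw [hE1]; exact one_pos)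
  have hAm : MeasurableSet A := hA.isCompact.isClosed.measurableSet
  have hmA1 : m A ≤ 1 := prob_le_one
  set g := (m A).toReal with hg
  have hg0 : 0 < g := ENNReal.toReal_pos hmA.ne' (measure_ne_top _ _)
  have hg1 : g ≤ 1 := by simpa using ENNReal.toReal_mono ENNReal.one_ne_top hmA1
  have hcond : ∀ B, ProbabilityTheory.cond m A B ≤ ENNReal.ofReal g⁻¹ * m B := by
    intro B
    rw [ProbabilityTheory.cond_apply hAm, ENNReal.ofReal_inv_of_pos hg0, hg,
      ENNReal.ofReal_toReal (measure_ne_top _ _)]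
    gcongr
    exact Set.inter_subset_right
  have hprob : IsProbabilityMeasure (ProbabilityTheory.cond m A) :=
    ProbabilityTheory.cond_isProbabilityMeasure hmA.ne'
  refine ⟨ProbabilityTheory.cond m A, A, φ, hprob, hA, hφ, hAE, ?_, g⁻¹ * (C + 1),
    fun p => R (φ p), by positivity, fun p => hR _, hanti.comp_strictMono hφ, hRφ, ?_⟩
  · rw [ProbabilityTheory.cond_apply hAm, Set.inter_compl_self, measure_empty, mul_zero]
  intro p hp B _ hBp
  have hC1 : 1 ≤ g⁻¹ * (C + 1) := by
    have : 1 ≤ g⁻¹ := (one_le_inv₀ hg0).2 hg1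
    nlinarith
  rcases B.eq_empty_or_nonempty with rfl | ⟨x, hx⟩
  · simp
  set u := s / θ - 2 / ((p : ℝ) - 1) with hu
  rcases eq_or_ne (Metric.ediam B) 0 with h0 | h0
  · -- a single point has mass zero, and `0 ^ u ≥ 1` if `u ≤ 0`
    rw [h0]
    rcases lt_or_ge 0 u with hu0 | hu0
    · have : B = {x} := (Metric.ediam_eq_zero_iff.1 h0).eq_singleton_of_mem hx
      have h1 := hcond B
      rw [this, hatom, mul_zero] at h1
      rw [this]
      exact h1.trans zero_le
    · have h1 : (1 : ℝ≥0∞) ≤ 0 ^ u := by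
        rcases hu0.lt_or_eq with h | h
        · rw [ENNReal.zero_rpow_of_neg h]; exact le_top
        · rw [h, ENNReal.rpow_zero]
      calc ProbabilityTheory.cond m A B ≤ 1 * 1 := by simpa using prob_le_one
        _ ≤ _ := by
          gcongr
          simpa using ENNReal.ofReal_le_ofReal hC1
  · have hfin : Metric.ediam B ≠ ⊤ := ne_top_of_le_ne_top ENNReal.ofReal_ne_top hBp
    set δ := (Metric.ediam B).toReal with hδ
    have hδ0 : 0 < δ := ENNReal.toReal_pos h0 hfin
    have hδe : Metric.ediam B = ENNReal.ofReal δ := (ENNReal.ofReal_toReal hfin).symm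
    have hδp : δ ≤ R (φ p) := by
      rw [hδe] at hBp
      exact (ENNReal.ofReal_le_ofReal_iff (hR _).le).1 hBp
    -- the scale of `B` lies between two consecutive scales of the construction
    obtain ⟨j, hpj, hj1, hj⟩ : ∃ j ≥ p, R (φ (j + 1)) ≤ δ ∧ δ ≤ R (φ j) := by
      classical
      have hex : ∃ i, R (φ (p + (i + 1))) ≤ δ := by
        have : Tendsto (fun i => R (φ (p + (i + 1)))) atTop (𝓝 0) :=
          hRφ.comp (tendsto_atTop_mono (fun i => show i ≤ p + (i + 1) by omega) tendsto_id)
        exact (this.eventually (ge_mem_nhds hδ0)).exists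
      refine ⟨p + Nat.find hex, by omega, Nat.find_spec hex, ?_⟩
      rcases Nat.eq_zero_or_pos (Nat.find hex) with h | h
      · rw [h]; exact hδp
      · have := Nat.find_min hex (m := Nat.find hex - 1) (by omega)
        rw [Nat.sub_add_cancel h] at this
        exact (not_le.1 this).le
    have hsub : B ⊆ Metric.ball x (2 * δ) := by
      intro y hy
      have h1 : edist y x ≤ Metric.ediam B := Metric.edist_le_ediam_of_mem hy hx
      rw [hδe, edist_dist, ENNReal.ofReal_le_ofReal_iff hδ0.le] at h1
      rw [Metric.mem_ball]
      linarith
    have hexp : 1 / ((j : ℝ) + 1) ≤ 2 / ((p : ℝ) - 1) := by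
      have h1 : (2 : ℝ) ≤ p := by exact_mod_cast hp
      have h2 : (p : ℝ) ≤ j := by exact_mod_cast hpj
      rw [div_le_div_iff₀ (by linarith) (by linarith)]
      linarith
    calc ProbabilityTheory.cond m A B ≤ ENNReal.ofReal g⁻¹ * m B := hcond B
      _ ≤ ENNReal.ofReal g⁻¹ * ENNReal.ofReal (C * δ ^ (s / θ - 1 / ((j : ℝ) + 1))) := by
        gcongr
        exact hB j δ x B hj1 hj hsub
      _ ≤ ENNReal.ofReal g⁻¹ * ENNReal.ofReal ((C + 1) * δ ^ u) := by
        have h1 : δ ^ (s / θ - 1 / ((j : ℝ) + 1)) ≤ δ ^ u :=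
          Real.rpow_le_rpow_of_exponent_ge hδ0 (hj.trans (hφ1 j).le) (by rw [hu]; linarith)
        have h2 : C ≤ C + 1 := by linarith
        gcongr
      _ = _ := by
        rw [hδe, ENNReal.ofReal_rpow_of_pos hδ0, ← ENNReal.ofReal_mul (by positivity),
          ← ENNReal.ofReal_mul (by positivity), mul_assoc]

/-- Sets of positive mass have dimension at least `u - 2 / (p - 1)` for every large `p`. -/
lemma le_measureDimH {m : Measure (Euc d)} {C u : ℝ} {η : ℕ → ℝ} (hC : 0 < C) (hu : 0 < u)
    (hη : ∀ p, 0 < η p)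
    (h : ∀ p : ℕ, 2 ≤ p → ∀ B : Set (Euc d), MeasurableSet B →
      Metric.ediam B ≤ ENNReal.ofReal (η p) →
        m B ≤ ENNReal.ofReal C * Metric.ediam B ^ (u - 2 / ((p : ℝ) - 1))) :
    ENNReal.ofReal u ≤ measureDimH K m := by
  refine le_iInf fun E => le_iInf fun _ => le_iInf fun hE => ?_
  have hlim : Tendsto (fun p : ℕ => u - 2 / ((p : ℝ) - 1)) atTop (𝓝 u) := by
    have h1 : Tendsto (fun p : ℕ => (p : ℝ) - 1) atTop atTop :=
      tendsto_atTop_add_const_right _ _ tendsto_natCast_atTop_atTop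
    simpa using (h1.const_div_atTop 2).const_sub u
  refine le_of_tendsto (ENNReal.tendsto_ofReal hlim) ?_
  filter_upwards [hlim.eventually (lt_mem_nhds hu), eventually_ge_atTop 2] with p hp0 hp2
  exact le_dimH_of_measure_le hC hp0.le (by simpa using hη p) (h p hp2) hE

/-! ### The dimension of the self-similar set -/

lemma exponent_pos (hk : 2 ≤ k) (h0 : ∀ i, 0 < α i) (h1 : ∀ i, α i < 1) {s : ℝ}
    (hs : ∑ i, α i ^ s = 1) : 0 < s := by
  by_contra! h
  have h2 : ∑ _i : Fin k, (1 : ℝ) ≤ ∑ i, α i ^ s := Finset.sum_le_sum fun i _ =>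
    Real.one_le_rpow_of_pos_of_le_one_of_nonpos (h0 i) (h1 i).le h
  rw [hs] at h2
  simp at h2
  have : (2 : ℝ) ≤ k := by exact_mod_cast hk
  linarith

/-- The words of length `n`, as sequences of letters, have total weight `1`. -/
lemma sum_wordRatio_rpow (h0 : ∀ i, 0 < α i) {s : ℝ} (hs : ∑ i, α i ^ s = 1) (n : ℕ) :
    ∑ w : Fin n → Fin k, wordRatio α (List.ofFn w) ^ s = 1 := by
  have h1 : ∀ w : Fin n → Fin k, wordRatio α (List.ofFn w) ^ s = ∏ i, α (w i) ^ s := by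
    intro w
    rw [wordRatio, List.map_ofFn, List.prod_ofFn, ← Real.finsetProd_rpow]
    · rfl
    · exact fun i _ => (h0 _).le
  simp_rw [h1]
  have h2 := Finset.prod_univ_sum (fun _ : Fin n => (Finset.univ : Finset (Fin k)))
    (fun _ i => α i ^ s)
  rw [Fintype.piFinset_univ] at h2
  rw [← h2]
  simp [hs]

lemma IsSelfSimilarSet.dimH_le (hK : IsSelfSimilarSet S K) (hS : IsSimilitudeSystem S α)
    {s : ℝ} (hs0 : 0 < s) (hs : ∑ i, α i ^ s = 1) : dimH K ≤ ENNReal.ofReal s := by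
  obtain ⟨a, b, -, -, hb0, hb1, -, hb⟩ := exists_ratio_bounds hS.ratio_pos hS.ratio_lt_one
  set D := Metric.diam K
  have hdiam : ∀ w : List (Fin k), Metric.ediam (wordMap S w '' K) ≤
      ENNReal.ofReal (wordRatio α w * D) := fun w =>
    Metric.ediam_le fun x hx y hy => by
      rw [edist_dist]
      exact ENNReal.ofReal_le_ofReal (hS.dist_le_of_mem_image hK.isCompact w hx hy)
  have hcover : ∀ n, K ⊆ ⋃ w : Fin n → Fin k, wordMap S (List.ofFn w) '' K := by
    intro n x hx
    obtain ⟨ω, -, hω⟩ := exists_code_of_mem hK [] (x := x) ⟨x, hx, rfl⟩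
    exact Set.mem_iUnion.2 ⟨fun i => ω i, hω n⟩
  have hle : μH[s] K ≤ liminf (fun n : ℕ => ∑ w : Fin n → Fin k,
      Metric.ediam (wordMap S (List.ofFn w) '' K) ^ s) atTop := by
    refine Measure.hausdorffMeasure_le_liminf_sum s K (fun n => ENNReal.ofReal (b ^ n * D)) ?_
      (fun n (w : Fin n → Fin k) => wordMap S (List.ofFn w) '' K) ?_ ?_
    · have := (tendsto_pow_atTop_nhds_zero_of_lt_one hb0.le hb1).mul_const D
      simpa using ENNReal.tendsto_ofReal this
    · refine Eventually.of_forall fun n w => (hdiam _).trans (ENNReal.ofReal_le_ofReal ?_)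
      refine mul_le_mul_of_nonneg_right ?_ Metric.diam_nonneg
      rw [wordRatio, List.map_ofFn, List.prod_ofFn]
      calc ∏ i, (α ∘ w) i ≤ ∏ _i : Fin n, b :=
            Finset.prod_le_prod (fun i _ => (hS.ratio_pos _).le) fun i _ => hb _
        _ = b ^ n := by simp
    · exact Eventually.of_forall hcover
  have hfin : μH[s] K ≤ ENNReal.ofReal (D ^ s) := by
    refine hle.trans (liminf_le_of_frequently_le' (Frequently.of_forall fun n => ?_))
    calc ∑ w : Fin n → Fin k, Metric.ediam (wordMap S (List.ofFn w) '' K) ^ s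
        ≤ ∑ w : Fin n → Fin k, ENNReal.ofReal (wordRatio α (List.ofFn w) ^ s * D ^ s) := by
          refine Finset.sum_le_sum fun w _ => ?_
          have hp := wordRatio_pos hS.ratio_pos (List.ofFn w)
          rw [← Real.mul_rpow hp.le Metric.diam_nonneg,
            ← ENNReal.ofReal_rpow_of_nonneg (mul_nonneg hp.le Metric.diam_nonneg) hs0.le]
          exact ENNReal.rpow_le_rpow (hdiam _) hs0.le
      _ = ENNReal.ofReal (D ^ s) := by
          rw [← ENNReal.ofReal_sum_of_nonneg, ← Finset.sum_mul,
            sum_wordRatio_rpow hS.ratio_pos hs, one_mul]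
          intro w _
          have := wordRatio_pos hS.ratio_pos (List.ofFn w)
          have := Metric.diam_nonneg (s := K)
          positivity
  have h := dimH_le_of_hausdorffMeasure_ne_top (s := K) (d := s.toNNReal) (by
    rw [Real.coe_toNNReal _ hs0.le]
    exact ne_top_of_le_ne_top ENNReal.ofReal_ne_top hfin)
  exact h

end CantorMeasure

/-! ### The distance `lipDist` and the weak topology -/

section LipDist

lemma abs_integral_sub_integral_le {X : Type*} [MeasurableSpace X] (μ ν : Measure X)
    [IsFiniteMeasure μ] [IsFiniteMeasure ν] {f : X → ℝ} {ε : ℝ} (hf : ∀ x, |f x| ≤ ε) :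
    |∫ x, f x ∂μ - ∫ x, f x ∂ν| ≤ ε * μ.real Set.univ + ε * ν.real Set.univ :=
  (norm_sub_le (∫ x, f x ∂μ) (∫ x, f x ∂ν)).trans <| add_le_add
    (norm_integral_le_of_norm_le_const (Eventually.of_forall hf))
    (norm_integral_le_of_norm_le_const (Eventually.of_forall hf))

variable {X : Type*} [MetricSpace X] [MeasurableSpace X]

lemma abs_integral_sub_integral_le_lipDist (μ ν : Measure X) [IsFiniteMeasure μ]
    [IsFiniteMeasure ν] {f : X → ℝ} (hf : LipschitzWith 1 f) (hf1 : ∀ x, |f x| ≤ 1) :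
    |∫ x, f x ∂μ - ∫ x, f x ∂ν| ≤ lipDist μ ν := by
  refine le_csSup ⟨1 * μ.real Set.univ + 1 * ν.real Set.univ, ?_⟩ ⟨f, hf, hf1, rfl⟩
  rintro _ ⟨g, -, hg1, rfl⟩
  exact abs_integral_sub_integral_le μ ν hg1

lemma lipDist_le {μ ν : Measure X} {r : ℝ}
    (h : ∀ f : X → ℝ, LipschitzWith 1 f → (∀ x, |f x| ≤ 1) → |∫ x, f x ∂μ - ∫ x, f x ∂ν| ≤ r) :
    lipDist μ ν ≤ r := by
  refine csSup_le ⟨_, 0, LipschitzWith.const' 0, by simp, rfl⟩ ?_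
  rintro _ ⟨f, hf, hf1, rfl⟩
  exact h f hf hf1

lemma lipDist_self_nonpos (μ : Measure X) : lipDist μ μ ≤ 0 :=
  lipDist_le fun f _ _ => by simp

open BoundedContinuousFunction in
/-- By the Arzelà-Ascoli theorem finitely many test functions determine `lipDist` up to `ε`, hence
its balls are open in the weak topology. -/
lemma isOpen_lipDist_lt [CompactSpace X] [BorelSpace X] (ν : Measure X) [IsFiniteMeasure ν]
    (r : ℝ) : IsOpen {μ : ProbabilityMeasure X | lipDist (μ : Measure X) ν < r} := by
  let F : Set (X →ᵇ ℝ) := {f | LipschitzWith 1 f ∧ ∀ x, |f x| ≤ 1}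
  have hF : TotallyBounded F := by
    refine (arzela_ascoli (Set.Icc (-1 : ℝ) 1) isCompact_Icc F
      (fun f x hf => abs_le.1 (hf.2 x)) ?_).totallyBounded.subset subset_closure
    exact (LipschitzWith.uniformEquicontinuous (fun f : F => (f : X → ℝ)) 1
      fun f => f.2.1).equicontinuous
  rw [isOpen_iff_mem_nhds]
  intro μ₀ hμ₀
  set ε := (r - lipDist (μ₀ : Measure X) ν) / 4 with hε
  have hμ₀' : lipDist (μ₀ : Measure X) ν < r := hμ₀
  have hε0 : 0 < ε := by rw [hε]; linarith
  obtain ⟨T, hT, hFT⟩ := Metric.totallyBounded_iff.1 hF ε hε0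
  have hnear : ∀ᶠ μ : ProbabilityMeasure X in 𝓝 μ₀, ∀ g ∈ T,
      |∫ x, g x ∂(μ : Measure X) - ∫ x, g x ∂(μ₀ : Measure X)| < ε := by
    rw [hT.eventually_all]
    intro g _
    have := (ProbabilityMeasure.continuous_integral_boundedContinuousFunction g).tendsto μ₀
    exact (Metric.tendsto_nhds.1 this ε hε0)
  filter_upwards [hnear] with μ hμ
  have hle : lipDist (μ : Measure X) ν ≤ lipDist (μ₀ : Measure X) ν + 3 * ε := by
    refine lipDist_le fun f hf hf1 => ?_
    let f' : X →ᵇ ℝ := BoundedContinuousFunction.ofNormedAddCommGroup f hf.continuous 1 hf1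
    have hf' : f' ∈ F := ⟨hf, hf1⟩
    obtain ⟨g, hg, hfg⟩ := Set.mem_iUnion₂.1 (hFT hf')
    have hdiff : ∀ x, |f' x - g x| ≤ ε := fun x => (f'.dist_coe_le_dist x).trans
      (Metric.mem_ball.1 hfg).le
    have h1 := abs_integral_sub_integral_le (μ : Measure X) (μ₀ : Measure X) hdiff
    rw [integral_sub (f'.integrable _) (g.integrable _),
      integral_sub (f'.integrable _) (g.integrable _)] at h1
    simp only [probReal_univ, mul_one] at h1
    have h2 := abs_integral_sub_integral_le_lipDist (μ₀ : Measure X) ν hf hf1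
    have h3 := hμ g hg
    change |∫ x, f' x ∂(μ : Measure X) - ∫ x, f' x ∂ν| ≤ _
    change |∫ x, f' x ∂(μ₀ : Measure X) - ∫ x, f' x ∂ν| ≤ _ at h2
    rw [abs_le] at h1 h2 ⊢
    rw [abs_lt] at h3
    constructor <;> linarith
  change lipDist (μ : Measure X) ν < r
  linarith

end LipDist

/-! ### Convex combinations of probability measures -/

section Mix

lemma isProbabilityMeasure_mix {X : Type*} [MeasurableSpace X] (P Q : Measure X)
    [IsProbabilityMeasure P] [IsProbabilityMeasure Q] {b : ℝ} (hb0 : 0 ≤ b) (hb1 : b ≤ 1) :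
    IsProbabilityMeasure (ENNReal.ofReal b • P + ENNReal.ofReal (1 - b) • Q) := by
  constructor
  simp only [Measure.add_apply, Measure.smul_apply, measure_univ, smul_eq_mul, mul_one]
  rw [← ENNReal.ofReal_add hb0 (by linarith), add_sub_cancel, ENNReal.ofReal_one]

variable {X : Type*} [MetricSpace X] [MeasurableSpace X] [BorelSpace X]

/-- Convex combinations `b P + (1 - b) Q` with `b → 0` and `Q → ξ` converge weakly to `ξ`,
whatever the measures `P`. -/
lemma tendsto_mix {ι : Type*} {l : Filter ι} {b : ι → ℝ} (hb0 : ∀ i, 0 ≤ b i)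
    (hb1 : ∀ i, b i ≤ 1) (hb : Tendsto b l (𝓝 0)) {P : ι → Measure X}
    {Q M : ι → ProbabilityMeasure X} (hP : ∀ᶠ i in l, IsProbabilityMeasure (P i))
    {ξ : ProbabilityMeasure X} (hQ : Tendsto Q l (𝓝 ξ))
    (hM : ∀ᶠ i in l, (M i : Measure X) =
      ENNReal.ofReal (b i) • P i + ENNReal.ofReal (1 - b i) • (Q i : Measure X)) :
    Tendsto M l (𝓝 ξ) := by
  rw [ProbabilityMeasure.tendsto_iff_forall_integral_tendsto] at hQ ⊢
  intro f
  have h1 : Tendsto (fun i => b i * ∫ x, f x ∂(P i)) l (𝓝 0) := by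
    refine squeeze_zero_norm' (a := fun i => b i * ‖f‖) ?_ (by simpa using hb.mul_const ‖f‖)
    filter_upwards [hP] with i hi
    rw [norm_mul, Real.norm_of_nonneg (hb0 i)]
    exact mul_le_mul_of_nonneg_left (f.norm_integral_le_norm _) (hb0 i)
  have h2 := h1.add (((hb.const_sub 1)).mul (hQ f))
  simp only [sub_zero, one_mul, zero_add] at h2
  refine h2.congr' ?_
  filter_upwards [hP, hM] with i hi hMi
  rw [hMi, integral_add_measure ((f.integrable _).smul_measure ENNReal.ofReal_ne_top)
    ((f.integrable _).smul_measure ENNReal.ofReal_ne_top), integral_smul_measure,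
    integral_smul_measure, ENNReal.toReal_ofReal (hb0 i),
    ENNReal.toReal_ofReal (sub_nonneg.2 (hb1 i)), smul_eq_mul, smul_eq_mul]

/-- The space of probability measures has no isolated points: a measure is the limit of its convex
combinations with a Dirac mass. -/
lemma nhdsNE_probabilityMeasure_neBot [Nontrivial X] (ξ : ProbabilityMeasure X) :
    (𝓝[≠] ξ).NeBot := by
  obtain ⟨x, hx⟩ : ∃ x : X, (ξ : Measure X) {x} ≠ 1 := by
    obtain ⟨x, y, hxy⟩ := exists_pair_ne X
    by_contra! h
    have h1 := measure_union (μ := (ξ : Measure X)) (Set.disjoint_singleton.2 hxy)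
      (measurableSet_singleton y)
    rw [h, h] at h1
    have h2 : (ξ : Measure X) ({x} ∪ {y}) ≤ 1 := prob_le_one
    rw [h1] at h2
    norm_num at h2
  let b : ℕ → ℝ := fun n => 1 / ((n : ℝ) + 1)
  have hb0 : ∀ n, 0 < b n := fun n => by positivity
  have hb1 : ∀ n, b n ≤ 1 := fun n => by
    rw [div_le_one (by positivity)]
    have : (0 : ℝ) ≤ n := n.cast_nonneg
    linarith
  let M : ℕ → ProbabilityMeasure X := fun n =>
    ⟨ENNReal.ofReal (b n) • Measure.dirac x + ENNReal.ofReal (1 - b n) • (ξ : Measure X),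
      isProbabilityMeasure_mix _ _ (hb0 n).le (hb1 n)⟩
  have hM : Tendsto M atTop (𝓝 ξ) :=
    tendsto_mix (fun n => (hb0 n).le) hb1 tendsto_one_div_add_atTop_nhds_zero_nat
      (P := fun _ => Measure.dirac x) (Q := fun _ => ξ)
      (Eventually.of_forall fun _ => inferInstance) tendsto_const_nhds
      (Eventually.of_forall fun _ => rfl)
  refine (tendsto_nhdsWithin_iff.2 ⟨hM, Eventually.of_forall fun n h => hx ?_⟩ :
    Tendsto M atTop (𝓝[≠] ξ)).neBot
  have h1 : (M n : Measure X) {x} = (ξ : Measure X) {x} := by rw [Set.mem_singleton_iff.1 h]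
  change (ENNReal.ofReal (b n) • Measure.dirac x + ENNReal.ofReal (1 - b n) •
    (ξ : Measure X)) {x} = (ξ : Measure X) {x} at h1
  simp only [Measure.add_apply, Measure.smul_apply,
    Measure.dirac_apply_of_mem (Set.mem_singleton x), smul_eq_mul,
    mul_one] at h1
  have h2 := congrArg ENNReal.toReal h1
  rw [ENNReal.toReal_add ENNReal.ofReal_ne_top
    (ENNReal.mul_ne_top ENNReal.ofReal_ne_top (measure_ne_top _ _)), ENNReal.toReal_mul,
    ENNReal.toReal_ofReal (hb0 n).le, ENNReal.toReal_ofReal (sub_nonneg.2 (hb1 n))] at h2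
  have h3 : ((ξ : Measure X) {x}).toReal = 1 := by
    have := hb0 n
    refine mul_left_cancel₀ this.ne' ?_
    linarith
  rwa [ENNReal.toReal_eq_one_iff] at h3

end Mix

/-! ### Typical measures -/

section Typical

variable {d k : ℕ} {α : Fin k → ℝ} {K : Set (Euc d)}

/-- The weights `α_w ^ s`, `w ∈ I(R)`, add up to `1`: they are the masses of the corresponding
cylinders for independent letters, and these cylinders partition the sequence space if `R < 1`,
hence the condition `1 ≤ J n`. -/
lemma isProbabilityMeasure_atomicMeasure (hk : 0 < k) (h0 : ∀ i, 0 < α i) (h1 : ∀ i, α i < 1)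
    {s : ℝ} (hs : ∑ i, α i ^ s = 1) {J : ℕ → ℕ} {n : ℕ} (hJ : 1 ≤ J n)
    (x : ℕ → List (Fin k) → K) : IsProbabilityMeasure (atomicMeasure α s J x n) := by
  obtain ⟨P, hP, hPt⟩ := exists_treeMeasure (fun _ i => ENNReal.ofReal (α i ^ s))
    fun _ => sum_ofReal_rpow_eq_one h0 hs
  have hcyl : ∀ ω n, P (PiNat.cylinder ω n) =
      ENNReal.ofReal (wordRatio α (initWord ω n) ^ s) := by
    intro ω n
    induction n with
    | zero => simp
    | succ n ih =>
      rw [hPt, ih, wordRatio_initWord_succ, Real.mul_rpow (wordRatio_pos h0 _).le (h0 _).le,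
        ENNReal.ofReal_mul (Real.rpow_nonneg (wordRatio_pos h0 _).le s)]
  set R : ℝ := (2 : ℝ) ^ (-(J n : ℝ)) with hR
  have hR0 : 0 < R := by positivity
  have hR1 : R < 1 := Real.rpow_lt_one_of_one_lt_of_neg one_lt_two
    (neg_lt_zero.2 (by exact_mod_cast hJ))
  have hcover : (⋃ w : cutWords α R, {ω : ℕ → Fin k | initWord ω w.1.length = w.1}) =
      Set.univ := by
    refine Set.eq_univ_of_forall fun ω => ?_
    obtain ⟨m, hm⟩ := exists_initWord_mem_cutWords h0 h1 hR0 hR1 ω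
    exact Set.mem_iUnion.2 ⟨⟨_, hm⟩, by simp⟩
  have hword : ∀ w : cutWords α R, ∃ (ω : ℕ → Fin k) (n : ℕ), w.1 = initWord ω n := by
    intro w
    obtain ⟨ω, n, h⟩ := exists_eq_initWord_of_mem_cutWords hk w.2
    exact ⟨ω, n + 1, h⟩
  constructor
  rw [atomicMeasure, Measure.sum_apply _ MeasurableSet.univ]
  simp only [Measure.smul_apply, measure_univ, smul_eq_mul, mul_one]
  rw [← measure_univ (μ := P), ← hcover, measure_iUnion]
  · refine tsum_congr fun w => ?_
    obtain ⟨ω, n, hw⟩ := hword w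
    rw [hw, setOf_initWord_eq, hcyl]
  · intro v w hvw
    refine Set.disjoint_left.2 fun ω hv hw => hvw (Subtype.ext ?_)
    rw [Set.mem_ofPred_eq] at hv hw
    obtain ⟨m, hm⟩ := Nat.exists_eq_succ_of_ne_zero (n := v.1.length) (by simpa using v.2.1)
    obtain ⟨n, hn⟩ := Nat.exists_eq_succ_of_ne_zero (n := w.1.length) (by simpa using w.2.1)
    rw [hm] at hv
    rw [hn] at hw
    have hv' : initWord ω (m + 1) ∈ cutWords α R := by rw [hv]; exact v.2
    have hw' : initWord ω (n + 1) ∈ cutWords α R := by rw [hw]; exact w.2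
    rw [← hv, ← hw, initWord_mem_cutWords_unique h0 h1 hv' hw']
  · intro w
    obtain ⟨ω, n, hw⟩ := hword w
    rw [hw, setOf_initWord_eq]
    exact measurableSet_cylinder ω n

lemma mixWeight_mem_Icc (J : ℕ → ℕ) (n : ℕ) : mixWeight J n ∈ Set.Icc (0 : ℝ) 1 :=
  ⟨by unfold mixWeight; positivity,
    Real.rpow_le_one_of_one_le_of_nonpos one_le_two (neg_nonpos.2 (by positivity))⟩

lemma tendsto_mixWeight {J : ℕ → ℕ}
    (hJ : Tendsto (fun n : ℕ => (J n : ℝ) / (n : ℝ)) atTop atTop) :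
    Tendsto (mixWeight J) atTop (𝓝 0) :=
  (tendsto_rpow_atBot_of_base_gt_one 2 one_lt_two).comp (tendsto_neg_atTop_atBot.comp hJ)

/-- The set of typical measures is a dense `Gδ`: the measures `μₗ` with `l ≥ n` are dense, since
`μₗ` is close to `νₗ`. -/
lemma isGδ_and_dense_typicalSet (hk : 0 < k) (h0 : ∀ i, 0 < α i) (h1 : ∀ i, α i < 1)
    (hK : IsCompact K) (hKn : K.Nontrivial) {s : ℝ} (hs : ∑ i, α i ^ s = 1) {J : ℕ → ℕ}
    (hJ : ∀ n ≥ 1, 1 ≤ J n) (hJn : Tendsto (fun n : ℕ => (J n : ℝ) / (n : ℝ)) atTop atTop)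
    (x : ℕ → List (Fin k) → K) (ν : ℕ → ProbabilityMeasure K) (hν : DenseRange ν) :
    IsGδ (typicalSet α s J x ν) ∧ Dense (typicalSet α s J x ν) := by
  have : CompactSpace K := isCompact_iff_compactSpace.1 hK
  have : Nontrivial K := hKn.coe_sort
  have hmix : ∀ l ≥ 1, IsProbabilityMeasure (mixMeasure α s J x ν l) := by
    intro l hl
    have := isProbabilityMeasure_atomicMeasure hk h0 h1 hs (hJ l hl) x
    exact isProbabilityMeasure_mix _ _ (mixWeight_mem_Icc J l).1 (mixWeight_mem_Icc J l).2
  have hopen : ∀ n ≥ 1, IsOpen (⋃ l ≥ n, {μ : ProbabilityMeasure K |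
      lipDist (μ : Measure K) (mixMeasure α s J x ν l) < (2 : ℝ) ^ (-(s * (J l : ℝ) ^ 2))}) := by
    intro n hn
    refine isOpen_biUnion fun l hl => ?_
    have := hmix l (hn.trans hl)
    exact isOpen_lipDist_lt _ _
  have hM : ∀ l, ∃ M : ProbabilityMeasure K, l ≥ 1 → (M : Measure K) = mixMeasure α s J x ν l := by
    intro l
    by_cases h : l ≥ 1
    · exact ⟨⟨mixMeasure α s J x ν l, hmix l h⟩, fun _ => rfl⟩
    · exact ⟨ν l, fun h' => absurd h' h⟩
  choose M hM using hM
  have hcluster : ∀ ξ : ProbabilityMeasure K, MapClusterPt ξ atTop ν := by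
    intro ξ
    rw [mapClusterPt_iff_frequently]
    intro O hO
    rw [frequently_atTop]
    intro n
    have : ∀ ζ : ProbabilityMeasure K, (𝓝[≠] ζ).NeBot := nhdsNE_probabilityMeasure_neBot
    have hd : Dense (Set.range ν \ (ν '' Set.Iio n)) :=
      hν.sdiff_finite ((Set.finite_Iio n).image ν)
    obtain ⟨_, ⟨⟨l, rfl⟩, hln⟩, hlO⟩ := hd.inter_nhds_nonempty hO
    exact ⟨l, not_lt.1 fun h => hln ⟨l, h, rfl⟩, hlO⟩
  have hdense : ∀ n ≥ 1, Dense (⋃ l ≥ n, {μ : ProbabilityMeasure K |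
      lipDist (μ : Measure K) (mixMeasure α s J x ν l) < (2 : ℝ) ^ (-(s * (J l : ℝ) ^ 2))}) := by
    intro n hn ξ
    obtain ⟨U, hU, hUξ⟩ := mapClusterPt_iff_ultrafilter.1 (hcluster ξ)
    have hMξ : Tendsto M U (𝓝 ξ) := by
      refine tendsto_mix (fun l => (mixWeight_mem_Icc J l).1) (fun l => (mixWeight_mem_Icc J l).2)
        ((tendsto_mixWeight hJn).mono_left hU) (P := atomicMeasure α s J x) ?_ hUξ ?_
      · exact hU ((eventually_ge_atTop 1).mono fun l hl =>
          isProbabilityMeasure_atomicMeasure hk h0 h1 hs (hJ l hl) x)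
      · exact hU ((eventually_ge_atTop 1).mono fun l hl => hM l hl)
    refine mem_closure_of_tendsto hMξ (hU ((eventually_ge_atTop n).mono fun l hl => ?_))
    refine Set.mem_iUnion₂.2 ⟨l, hl, ?_⟩
    rw [Set.mem_ofPred_eq, hM l (hn.trans hl)]
    exact (lipDist_self_nonpos _).trans_lt (by positivity)
  constructor
  · exact IsGδ.biInter (Set.to_countable _) fun n hn => (hopen n hn).isGδ
  · exact dense_biInter_of_isOpen hopen (Set.to_countable _) hdense

lemma exists_isApproxSeq {s : ℝ} {J : ℕ → ℕ} {x : ℕ → List (Fin k) → K}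
    {ν : ℕ → ProbabilityMeasure K} {μ : ProbabilityMeasure K} (hμ : μ ∈ typicalSet α s J x ν) :
    ∃ N, IsApproxSeq α s J x ν μ N := by
  have hfreq : ∃ᶠ l in atTop, lipDist (μ : Measure K) (mixMeasure α s J x ν l) <
      (2 : ℝ) ^ (-(s * (J l : ℝ) ^ 2)) := by
    rw [frequently_atTop]
    intro n
    have h1 := Set.mem_iInter₂.1 hμ (max n 1) (le_max_right _ _)
    obtain ⟨l, hl, h⟩ := Set.mem_iUnion₂.1 h1
    exact ⟨l, (le_max_left _ _).trans hl, h⟩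
  obtain ⟨N, hN, h⟩ := extraction_of_frequently_atTop hfreq
  exact ⟨N, hN, fun p _ => h p⟩

end Typical

/-! ### The Cantor measures on the sets `Λ_θ` -/

section Main

variable {d k : ℕ} {S : Fin k → Euc d → Euc d} {α : Fin k → ℝ} {K : Set (Euc d)}

/-- The Cantor measure on `Λ_θ` exists for every strictly increasing sequence `N`. -/
lemma exists_cantor_measure_approxSet (hk : 0 < k) (hS : IsSimilitudeSystem S α)
    (hU : OpenSetCondition S) (hK : IsSelfSimilarSet S K) {s : ℝ} (hs0 : 0 < s)
    (hs : ∑ i, α i ^ s = 1) {J : ℕ → ℕ} (hJ : StrictMono J) (x : ℕ → List (Fin k) → K)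
    (hx : ∀ n ≥ 1, ∀ w ∈ cutWords α ((2 : ℝ) ^ (-(J n : ℝ))),
      (x n w : Euc d) ∈ wordMap S w '' K)
    {N : ℕ → ℕ} (hN : StrictMono N) {θ : ℝ} (hθ : 1 ≤ θ) :
    ∃ (m : Measure (Euc d)) (A : Set (Euc d)),
      IsProbabilityMeasure m ∧
      IsCantorSet A ∧ A ⊆ approxSet α J x N θ ∧ m Aᶜ = 0 ∧
      (∃ (C : ℝ) (η : ℕ → ℝ), 0 < C ∧ (∀ p, 0 < η p) ∧ StrictAnti η ∧
        Tendsto η atTop (𝓝 0) ∧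
        ∀ p : ℕ, 2 ≤ p → ∀ B : Set (Euc d), MeasurableSet B →
          Metric.ediam B ≤ ENNReal.ofReal (η p) →
          m B ≤ ENNReal.ofReal C *
            Metric.ediam B ^ (s / θ - 2 / ((p : ℝ) - 1))) ∧
      ENNReal.ofReal (s / θ) ≤ measureDimH K m := by
  have hJN : StrictMono fun p => J (N p) := hJ.comp hN
  have hanti : StrictAnti fun p => (2 : ℝ) ^ (-(J (N p) : ℝ)) := fun p q hpq =>
    Real.rpow_lt_rpow_of_exponent_lt one_lt_two
      (neg_lt_neg (Nat.cast_lt.2 (hJN hpq)))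
  have hlim : Tendsto (fun p => (2 : ℝ) ^ (-(J (N p) : ℝ))) atTop (𝓝 0) :=
    (tendsto_rpow_atBot_of_base_gt_one 2 one_lt_two).comp
      (tendsto_neg_atTop_atBot.comp (tendsto_natCast_atTop_atTop.comp hJN.tendsto_atTop))
  obtain ⟨m, A, φ, hm, hA, hφ, hAE, hm0, C, η, hC, hη, hηa, hηl, hB⟩ :=
    exists_cantor_measure hk hS hU hK hs0 hs (fun p => by positivity) hanti hlim
      (fun p v => (x (N p) v : Euc d)) (fun p hp => hx (N p) (hp.trans hN.le_apply)) hθ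
  refine ⟨m, A, hm, hA, hAE.trans ?_, hm0, ⟨C, η, hC, hη, hηa, hηl, hB⟩,
    le_measureDimH hC (by positivity) hη hB⟩
  rintro z ⟨hzK, hz⟩
  refine Set.mem_iInter₂.2 fun P _ => Set.mem_iUnion₂.2 ⟨φ P, hφ.le_apply, ?_⟩
  obtain ⟨v, hv, hzv⟩ := Set.mem_iUnion₂.1 (Set.mem_iInter.1 hz P)
  refine Set.mem_iUnion₂.2 ⟨v, hv, ?_, hzK⟩
  rwa [← Real.rpow_mul zero_le_two, neg_mul, mul_comm _ θ] at hzv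

lemma approxSet_subset (J : ℕ → ℕ) (x : ℕ → List (Fin k) → K) (N : ℕ → ℕ) (θ : ℝ) :
    approxSet α J x N θ ⊆ K := by
  intro z hz
  obtain ⟨p, -, hp⟩ := Set.mem_iUnion₂.1 (Set.mem_iInter₂.1 hz 1 le_rfl)
  obtain ⟨v, -, -, h⟩ := Set.mem_iUnion₂.1 hp
  exact h

end Main

theorem mainTheorem4 {d k : ℕ} (hk : 2 ≤ k)
    (S : Fin k → Euc d → Euc d) (α : Fin k → ℝ) (hS : IsSimilitudeSystem S α)
    (hU : OpenSetCondition S)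
    (K : Set (Euc d)) (hK : IsSelfSimilarSet S K)
    (s : ℝ) (hs : ∑ i, α i ^ s = 1)
    (J : ℕ → ℕ) (hJ : StrictMono J)
    (hJn : Tendsto (fun n : ℕ => (J n : ℝ) / (n : ℝ)) atTop atTop)
    (x : ℕ → List (Fin k) → K)
    (hx : ∀ n ≥ 1, ∀ w ∈ cutWords α ((2 : ℝ) ^ (-(J n : ℝ))),
      (x n w : Euc d) ∈ wordMap S w '' K)
    (ν : ℕ → ProbabilityMeasure K) (hν : DenseRange ν) :
    dimH K = ENNReal.ofReal s ∧
    IsGδ (typicalSet α s J x ν) ∧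
    Dense (typicalSet α s J x ν) ∧ typicalSet α s J x ν ∈ residual (ProbabilityMeasure K) ∧
    ∀ μ ∈ typicalSet α s J x ν,
      (∃ N : ℕ → ℕ, IsApproxSeq α s J x ν μ N) ∧
      ∀ N : ℕ → ℕ, IsApproxSeq α s J x ν μ N →
        ∀ θ : ℝ, 1 ≤ θ →
          ∃ (m : Measure (Euc d)) (A : Set (Euc d)),
            IsProbabilityMeasure m ∧
            IsCantorSet A ∧ A ⊆ approxSet α J x N θ ∧ m Aᶜ = 0 ∧
            (∃ (C : ℝ) (η : ℕ → ℝ), 0 < C ∧ (∀ p, 0 < η p) ∧ StrictAnti η ∧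
              Tendsto η atTop (𝓝 0) ∧
              ∀ p : ℕ, 2 ≤ p → ∀ B : Set (Euc d), MeasurableSet B →
                Metric.ediam B ≤ ENNReal.ofReal (η p) →
                m B ≤ ENNReal.ofReal C *
                  Metric.ediam B ^ (s / θ - 2 / ((p : ℝ) - 1))) ∧
            ENNReal.ofReal (s / θ) ≤ measureDimH K m := by
  have hk0 : 0 < k := by omega
  have hs0 := exponent_pos hk hS.ratio_pos hS.ratio_lt_one hs
  have hdim : dimH K = ENNReal.ofReal s := by
    refine le_antisymm (hK.dimH_le hS hs0 hs) ?_
    -- the lower bound is the dimension of the Cantor measure for `θ = 1` and any sequence `N`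
    obtain ⟨m, A, hm, hA, hAsub, hmA, -, hle⟩ :=
      exists_cantor_measure_approxSet hk0 hS hU hK hs0 hs hJ x hx strictMono_id le_rfl
    rw [div_one] at hle
    refine hle.trans (iInf_le_of_le K (iInf_le_of_le subset_rfl (iInf_le_of_le ?_ le_rfl)))
    have h1 : m A = 1 := (prob_compl_eq_zero_iff hA.isCompact.isClosed.measurableSet).1 hmA
    exact (h1 ▸ one_pos : 0 < m A).trans_le
      (measure_mono (hAsub.trans (approxSet_subset J x _ _)))
  have hKn : K.Nontrivial := by
    by_contra h
    rw [dimH_subsingleton (Set.not_nontrivial_iff.1 h)] at hdim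
    exact (ENNReal.ofReal_pos.2 hs0).ne hdim
  have hJ1 : ∀ n ≥ 1, 1 ≤ J n := fun n hn => hn.trans hJ.le_apply
  obtain ⟨hGδ, hdense⟩ := isGδ_and_dense_typicalSet hk0 hS.ratio_pos hS.ratio_lt_one
    hK.isCompact hKn hs hJ1 hJn x ν hν
  exact ⟨hdim, hGδ, hdense, residual_of_dense_Gδ hGδ hdense, fun μ hμ =>
    ⟨exists_isApproxSeq hμ, fun N hN θ hθ =>
      exists_cantor_measure_approxSet hk0 hS hU hK hs0 hs hJ x hx hN.1 hθ⟩⟩
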